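/- **Conventions.** For a local ring $B$ write $\mathfrak m_B$ for its maximal ideal. The integral closure of a domain $B$ in a field $L$ containing it is $\overline{B}^L$, and $\overline{B}$ is the integral closure of $B$ in its quotient field. An overring of a domain is a ring between it and its quotient field. For a domain $A$ with quotient field $F$ and an indeterminate $t$, the Nagata ring of $A$ is $$A(t)=\{f/g : f,g\in A[t],\ \text{the coefficients of } g \text{ generate the unit ideal of } A\}\subseteq F(t).$$ For an integrally closed domain $B$, the Kronecker function ring is $Kr(B)=\bigcap_V V(t)$, where $V$ runs through the valuation overrings of $B$. A domain $A$ is called maximal excluding if, for some $\alpha$ in its quotient field, $A$ is maximal among the overrings of $A$ that do not contain $\alpha$. **Setting.** Let $D$ be a local domain with quotient field $F$, and let $F'\supseteq\mathbb Q$ be a subfield of $F$ such that $F/F'$ is a finite Galois extension, generated as an $F'$-vector space by $\theta_1=1,\theta_2,\dots,\theta_n$. Let $K$ be the field generated over $\mathbb Q$ by all the conjugates of the $\theta_i$ under $\mathrm{Gal}(F/F')$. Assume that there is a finite chain of fields $F'=E_0\subseteq E_1\subseteq\dots\subseteq E_r=F$ such that every step $E/E'=E_{i+1}/E_i$ is a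 Galois extension satisfying one of the following conditions (this holds in particular if every extension $E/E'$ with $F'\subseteq E'\subseteq E\subseteq F$ is Galois and satisfies one of them): * $(\ast_1)$ $K\subseteq\overline D$; * $(\ast_2)$ $E$ is generated as an $E'$-vector space by $1,\vartheta,\dots,\vartheta^{m-1}$, where $\vartheta$ is a simple root of degree $m$ over $E'$ (its minimal polynomial over $E'$ is $X^m-a$ for some $a \in E'$), and $\xi\vartheta^m\in\overline D$ for every $m$-th root of unity $\xi$. Suppose that there is a local integrally closed domain $D'\supseteq\mathbb Q$ with quotient field $F'$ such that $\mathfrak m_{D'}\subseteq\mathfrak m_D$, $D=D'[\mathfrak m_D]_{\mathfrak m_D}$ and $\overline{D'}^F=\overline D=D[\theta_1,\dots,\theta_n]$. For a valuation overring $V$ of $D'$ with $\mathfrak m_V\supseteq\mathfrak m_{D'}$ put $A_V=V[\mathfrak m_D]_{(\mathfrak m_V,\mathfrak m_D)}$, and suppose that the intersection of all these rings $A_V$ is $D$. Let $\mathcal F$ be the family of all maximal excluding overrings $A$ of $D$ such that $A\supseteq A_V$ for some such $V$, and let $$R=Kr^{\mathcal F}(D)=\bigcap_{A\in\mathcal F}A(t).$$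 **Theorem.** The quotient field of $R$ is $F(t)$, and the integral closure of $R$ is $\overline R=Kr(\overline D)$. For every maximal ideal $\mathfrak p$ of $R$ there is a valuation overring $V$ of $D'$ with $\mathfrak m_V\supseteq\mathfrak m_{D'}$ such that $A_V(t)$ is local, $\mathfrak p=\mathfrak m_{A_V(t)}\cap R$ and $R_{\mathfrak p}=A_V(t)$. -/

import Mathlib

open Polynomial

namespace KrRing

/-! ## Subrings of a field: maximal ideals, integral closures, localizations -/

/-- The set of nonunits of a subring `B` of a field. When `B` is local, this is its maximal
ideal `𝔪_B`, viewed as a subset of the field. -/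
def nonunitSet {L : Type*} [Field L] (B : Subring L) : Set L :=
  {x | ∃ h : x ∈ B, ¬ IsUnit (⟨x, h⟩ : B)}

/-- The integral closure of `B` in the ambient field `L`. When `L` is the quotient field of `B`
this is the integral closure of `B`. -/
def intClosure {L : Type*} [Field L] (B : Subring L) : Subring L :=
  (integralClosure B L).toSubring

/-- The localization `B_P`, as a subring of the ambient field: the ring generated by `B` and the
inverses of the elements of `B` outside `P`. See `mem_localizationAt` for the description by
fractions when `P` is prime. -/
def localizationAt {L : Type*} [Field L] (B : Subring L) (P : Ideal B) : Subring L :=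
  Subring.closure ((B : Set L) ∪ {x | ∃ b : B, b ∉ P ∧ x = (b : L)⁻¹})

theorem mem_localizationAt {L : Type*} [Field L] (B : Subring L) (P : Ideal B) [hP : P.IsPrime]
    (x : L) : x ∈ localizationAt B P ↔ ∃ a b : B, b ∉ P ∧ x = (a : L) / (b : L) := by
  have hne : ∀ b : B, b ∉ P → (b : L) ≠ 0 := by
    intro b hb h0
    apply hb
    have : b = 0 := Subtype.ext h0
    rw [this]
    exact P.zero_mem
  have h1 : (1 : B) ∉ P := fun h => hP.ne_top ((Ideal.eq_top_iff_one P).2 h)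
  constructor
  · intro hx
    refine Subring.closure_induction
      (p := fun x _ => ∃ a b : B, b ∉ P ∧ x = (a : L) / (b : L)) ?_ ?_ ?_ ?_ ?_ ?_ hx
    · rintro y (hy | ⟨b, hb, rfl⟩)
      · exact ⟨⟨y, hy⟩, 1, h1, by simp⟩
      · exact ⟨1, b, hb, by simp⟩
    · exact ⟨0, 1, h1, by simp⟩
    · exact ⟨1, 1, h1, by simp⟩
    · rintro y z _ _ ⟨a, b, hb, rfl⟩ ⟨c, d, hd, rfl⟩
      refine ⟨a * d + b * c, b * d, fun h => (hP.mem_or_mem h).elim hb hd, ?_⟩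
      have hb' := hne b hb
      have hd' := hne d hd
      push_cast
      field_simp
    · rintro y _ ⟨a, b, hb, rfl⟩
      exact ⟨-a, b, hb, by push_cast; ring⟩
    · rintro y z _ _ ⟨a, b, hb, rfl⟩ ⟨c, d, hd, rfl⟩
      refine ⟨a * c, b * d, fun h => (hP.mem_or_mem h).elim hb hd, ?_⟩
      push_cast
      rw [div_mul_div_comm]
  · rintro ⟨a, b, hb, rfl⟩
    rw [div_eq_mul_inv]
    exact Subring.mul_mem _ (Subring.subset_closure (Or.inl a.2))
      (Subring.subset_closure (Or.inr ⟨b, hb, rfl⟩))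

/-- `B[S]`, the subring generated by the subring `B` and the set `S`. -/
def adjoin {L : Type*} [Field L] (B : Subring L) (S : Set L) : Subring L :=
  Subring.closure ((B : Set L) ∪ S)

/-- The ring `B[S]_{(T)}`: the localization of `B[S]` at the ideal generated in `B[S]` by those
elements of the ambient field that lie in `T` (used for sets `T` contained in `B[S]`). -/
def adjoinLocalized {L : Type*} [Field L] (B : Subring L) (S T : Set L) : Subring L :=
  localizationAt (adjoin B S) (Ideal.span {x : adjoin B S | (x : L) ∈ T})

/-! ## Nagata rings and Kronecker function rings -/

/-- The Nagata ring `A(t)` of a subring `A` of a field `F`, inside `F(t)`: the fractions `f / g`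
of polynomials over `A` such that the coefficients of `g` generate the unit ideal of `A`. -/
noncomputable def nagataRing {F : Type*} [Field F] (A : Subring F) : Subring (RatFunc F) where
  carrier := {φ | ∃ f g : A[X], g.contentIdeal = ⊤ ∧
    φ = algebraMap F[X] (RatFunc F) (f.map A.subtype) /
      algebraMap F[X] (RatFunc F) (g.map A.subtype)}
  zero_mem' := ⟨0, 1, by simp, by simp⟩
  one_mem' := ⟨1, 1, by simp, by simp⟩
  neg_mem' := by
    rintro _ ⟨f, g, hg, rfl⟩
    exact ⟨-f, g, hg, by simp [neg_div]⟩
  mul_mem' := by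
    rintro _ _ ⟨f, g, hg, rfl⟩ ⟨f', g', hg', rfl⟩
    exact ⟨f * f', g * g', contentIdeal_mul_eq_top_of_contentIdeal_eq_top hg hg', by
      simp [div_mul_div_comm]⟩
  add_mem' := by
    rintro _ _ ⟨f, g, hg, rfl⟩ ⟨f', g', hg', rfl⟩
    have key : ∀ p : A[X], p.contentIdeal = ⊤ →
        algebraMap F[X] (RatFunc F) (p.map A.subtype) ≠ 0 := by
      intro p hp h0
      rw [map_eq_zero_iff _ (IsFractionRing.injective F[X] (RatFunc F)),
        Polynomial.map_eq_zero_iff A.subtype_injective] at h0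
      rw [h0, contentIdeal_zero] at hp
      exact bot_ne_top hp
    refine ⟨f * g' + g * f', g * g', contentIdeal_mul_eq_top_of_contentIdeal_eq_top hg hg', ?_⟩
    rw [div_add_div _ _ (key g hg) (key g' hg')]
    simp

/-- The ring `⋂_{A ∈ 𝓕} A(t)`; for a defining family `𝓕` of a domain `D` this is the Kronecker
function ring `Kr^𝓕(D)` of `D` with respect to `𝓕`. -/
noncomputable def krFamily {F : Type*} [Field F] (𝓕 : Set (Subring F)) : Subring (RatFunc F) :=
  ⨅ A ∈ 𝓕, nagataRing A

/-- The valuation overrings of a domain `D` with quotient field `F`. -/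
def valuationOverrings {F : Type*} [Field F] (D : Subring F) : Set (ValuationSubring F) :=
  {V | D ≤ V.toSubring}

/-- The classical Kronecker function ring `Kr(D) = ⋂ V(t)`, where `V` runs through the valuation
overrings of the integrally closed domain `D`. -/
noncomputable def kr {F : Type*} [Field F] (D : Subring F) : Subring (RatFunc F) :=
  krFamily (ValuationSubring.toSubring '' valuationOverrings D)

/-- `A`, a domain with quotient field `F`, is a maximal excluding domain: it is maximal among the
subrings of `F` that do not contain a certain element `α` of `F`. -/
def IsMaximalExcluding {F : Type*} [Field F] (A : Subring F) : Prop :=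
  ∃ α : F, Maximal (fun B : Subring F => α ∉ B) A

/-! ## The conditions on the field extension -/

section Extension

variable {F' F : Type*} [Field F'] [Field F] [Algebra F' F]

/-- The field `K` generated over `ℚ` by the `θ i` and all their conjugates under `Gal(F/F')`. -/
def conjugateField {ι : Type*} (θ : ι → F) : Subfield F :=
  Subfield.closure {x | ∃ (σ : F ≃ₐ[F'] F) (i : ι), x = σ (θ i)}

/-- The extension `E/E'` is generated as a vector space by `1, ϑ, …, ϑ ^ (m - 1)`, where `ϑ` is a
simple root of degree `m` over `E'` (its minimal polynomial is `X ^ m - a`), and `Dbar` contains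
`ξ * ϑ ^ m` for all `m`-th roots of unity `ξ`. -/
def SimpleRootCondition (Dbar : Subring F) {E' E : IntermediateField F' F} (h : E' ≤ E) : Prop :=
  ∃ (ϑ : F) (m : ℕ),
    (∃ a : E', minpoly E' ϑ = X ^ m - C a) ∧
    Submodule.span E' (Set.range fun i : Fin m => ϑ ^ (i : ℕ)) =
      (IntermediateField.extendScalars h).toSubalgebra.toSubmodule ∧
    ∀ ξ : F, ξ ^ m = 1 → ξ * ϑ ^ m ∈ Dbar

/-- One step `E/E'`: a Galois extension such that either `K ⊆ Dbar` or `E/E'` is generated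
by the powers of a simple root as in `SimpleRootCondition`. -/
def StepCondition (K : Subfield F) (Dbar : Subring F) {E' E : IntermediateField F' F}
    (h : E' ≤ E) : Prop :=
  IsGalois E' (IntermediateField.extendScalars h) ∧
    ((K : Set F) ⊆ (Dbar : Set F) ∨ SimpleRootCondition Dbar h)

/-- `F/F'` is filtered by a finite chain `F' = E 0 ≤ E 1 ≤ … ≤ E r = F` of intermediate fields
whose steps all satisfy `StepCondition`. -/
def ChainCondition (K : Subfield F) (Dbar : Subring F) : Prop :=
  ∃ (r : ℕ) (E : ℕ → IntermediateField F' F), E 0 = ⊥ ∧ E r = ⊤ ∧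
    ∀ i < r, ∃ h : E i ≤ E (i + 1), StepCondition K Dbar h

/-- In particular the chain condition holds if every intermediate extension `E/E'` satisfies
`StepCondition`. -/
theorem ChainCondition.of_forall (K : Subfield F) (Dbar : Subring F)
    (H : ∀ (E' E : IntermediateField F' F) (h : E' ≤ E), StepCondition K Dbar h) :
    ChainCondition (F' := F') K Dbar := by
  refine ⟨1, fun i => if i = 0 then ⊥ else ⊤, by simp, by simp, ?_⟩
  intro i hi
  obtain rfl : i = 0 := by omega
  exact ⟨by simp, H _ _ _⟩

/-! ## The rings `A_V` and the family `𝓕` -/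

/-- The valuation overrings `V` of `D'` (in its quotient field `F'`) such that `𝔪_V ⊇ 𝔪_{D'}`. -/
def dominatingValuations (D' : Subring F') : Set (ValuationSubring F') :=
  {V | V ∈ valuationOverrings D' ∧ nonunitSet D' ⊆ nonunitSet V.toSubring}

/-- `A_V = V[𝔪_D]_{(𝔪_V, 𝔪_D)}`, a subring of `F`. -/
def ringA (D : Subring F) (V : ValuationSubring F') : Subring F :=
  adjoinLocalized (V.toSubring.map (algebraMap F' F)) (nonunitSet D)
    (algebraMap F' F '' nonunitSet V.toSubring ∪ nonunitSet D)

/-- The family of all the maximal excluding overrings `A` (subrings of `F`) that contain `A_V` for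
some valuation overring `V` of `D'` with `𝔪_V ⊇ 𝔪_{D'}`. -/
def maxExcludingFamily (D' : Subring F') (D : Subring F) : Set (Subring F) :=
  {A | IsMaximalExcluding A ∧ ∃ V ∈ dominatingValuations D', ringA D V ≤ A}

end Extension

end KrRing

/-! The engine is that `F/F'` is algebraic: every nonzero polynomial over `F` divides a nonzero
polynomial `G` over `F'`, and over a valuation ring `V` of `F'` some coefficient of `G` divides all
the others. So every element of `F(t)` is `h/G` with `G` over `V` having a coefficient `1`. For a
local ring `A ⊇ A_V`, such a fraction lies in `A(t)` exactly when the coefficients of `h` lie in `A`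
(`coeff_mem_of_mul_coeff_mem`, by Nakayama). By Zorn, `A_V` is the intersection of the maximal
excluding rings above it; hence `R` is the intersection of the rings `A_V(t)` (`mem_krFamily_iff`).
In particular `R` contains each coefficient of `G` divided by `G`, for every `G ≠ 0` over `F'`
(`coeff_div_mem_krFamily`), so it behaves like a Kronecker function ring over `F'`.

Integral closure: `R̄` is the intersection of the valuation rings `U ⊇ R` of `F(t)`. The quotients
above force `U ⊇ W(t)` with `W = U ∩ F`, a valuation overring of `D`. Conversely, every valuation
overring of `D` contains some `A_V`, so its Nagata ring is a valuation ring containing `R`.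

Localizations: let `L = R_p` with `p` maximal. The quotients for `G = t + x` show that `V = L ∩ F'`
is a valuation ring. Since `𝔪_D` lies in the Jacobson radical of `R`, the local ring `L ∩ F`
dominates `D` and `V`, hence also `A_V`. As `A_V` and `V` have the same residue field, a primitive
polynomial over `A_V` is, modulo `𝔪_L`, a primitive polynomial over `V`, which is invertible in `L`.
Thus `R ⊆ A_V(t) ⊆ R_p`, and `A_V(t)` is local, which forces equality on the right. -/

namespace KrRing

/-! ## Nonunits of local subrings -/

section Nonunits

variable {L : Type*} [Field L] {B : Subring L}

theorem isUnit_mk_iff {x : L} (hx : x ∈ B) : IsUnit (⟨x, hx⟩ : B) ↔ x ≠ 0 ∧ x⁻¹ ∈ B := by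
  constructor
  · intro h
    obtain ⟨⟨y, hy⟩, hxy⟩ := isUnit_iff_exists_inv.1 h
    have h1 : x * y = 1 := congrArg Subtype.val hxy
    refine ⟨left_ne_zero_of_mul_eq_one h1, ?_⟩
    rwa [inv_eq_of_mul_eq_one_right h1]
  · rintro ⟨h0, h⟩
    exact isUnit_iff_exists_inv.2 ⟨⟨x⁻¹, h⟩, Subtype.ext (mul_inv_cancel₀ h0)⟩

theorem mem_nonunitSet_iff {x : L} : x ∈ nonunitSet B ↔ x ∈ B ∧ (x ≠ 0 → x⁻¹ ∉ B) := by
  constructor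
  · rintro ⟨h, hx⟩
    exact ⟨h, fun h0 h1 => hx ((isUnit_mk_iff h).2 ⟨h0, h1⟩)⟩
  · rintro ⟨h, hx⟩
    exact ⟨h, fun hu => hx ((isUnit_mk_iff h).1 hu).1 ((isUnit_mk_iff h).1 hu).2⟩

theorem ne_zero_and_inv_mem {x : L} (hx : x ∈ B) (hn : x ∉ nonunitSet B) :
    x ≠ 0 ∧ x⁻¹ ∈ B := by
  by_contra h
  exact hn ⟨hx, fun hu => h ((isUnit_mk_iff hx).1 hu)⟩

theorem notMem_nonunitSet {x : L} (h0 : x ≠ 0) (hx : x⁻¹ ∈ B) : x ∉ nonunitSet B :=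
  fun h => (mem_nonunitSet_iff.1 h).2 h0 hx

theorem one_notMem_nonunitSet : (1 : L) ∉ nonunitSet B :=
  notMem_nonunitSet one_ne_zero (by simp)

theorem zero_mem_nonunitSet : (0 : L) ∈ nonunitSet B :=
  mem_nonunitSet_iff.2 ⟨B.zero_mem, fun h => absurd rfl h⟩

theorem mem_maximalIdeal_iff [IsLocalRing B] {x : B} :
    x ∈ IsLocalRing.maximalIdeal B ↔ (x : L) ∈ nonunitSet B := by
  rw [IsLocalRing.mem_maximalIdeal]
  exact ⟨fun h => ⟨x.2, h⟩, fun h => h.2⟩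

theorem add_mem_nonunitSet [IsLocalRing B] {x y : L} (hx : x ∈ nonunitSet B)
    (hy : y ∈ nonunitSet B) : x + y ∈ nonunitSet B :=
  mem_maximalIdeal_iff.1 ((IsLocalRing.maximalIdeal B).add_mem
    (mem_maximalIdeal_iff (x := ⟨x, hx.1⟩).2 hx) (mem_maximalIdeal_iff (x := ⟨y, hy.1⟩).2 hy))

theorem mul_mem_nonunitSet {x y : L} (hx : x ∈ B) (hy : y ∈ nonunitSet B) :
    x * y ∈ nonunitSet B := by
  refine ⟨B.mul_mem hx hy.1, fun hu => hy.2 ?_⟩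
  exact isUnit_of_mul_isUnit_right (x := (⟨x, hx⟩ : B)) (y := ⟨y, hy.1⟩) hu

theorem neg_mem_nonunitSet {x : L} (hx : x ∈ nonunitSet B) : -x ∈ nonunitSet B := by
  simpa using mul_mem_nonunitSet (B.neg_mem B.one_mem) hx

theorem sum_mem_nonunitSet [IsLocalRing B] {ι : Type*} (s : Finset ι) {f : ι → L}
    (hf : ∀ i ∈ s, f i ∈ nonunitSet B) : ∑ i ∈ s, f i ∈ nonunitSet B := by
  classical
  induction s using Finset.induction_on with
  | empty => simpa using zero_mem_nonunitSet
  | insert a s ha ih =>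
    rw [Finset.sum_insert ha]
    exact add_mem_nonunitSet (hf a (by simp)) (ih fun i hi => hf i (by simp [hi]))

theorem add_notMem_nonunitSet [IsLocalRing B] {x y : L}
    (hx : x ∉ nonunitSet B) (hy : y ∈ nonunitSet B) : x + y ∉ nonunitSet B := fun h =>
  hx (by simpa using add_mem_nonunitSet h (neg_mem_nonunitSet hy))

theorem isLocalRing_of_inv_mem {B : Subring L}
    (h : ∀ x ∈ B, (x ≠ 0 ∧ x⁻¹ ∈ B) ∨ (1 - x ≠ 0 ∧ (1 - x)⁻¹ ∈ B)) : IsLocalRing B := by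
  refine IsLocalRing.of_isUnit_or_isUnit_one_sub_self fun x => ?_
  have h1 := isUnit_mk_iff (1 - x : B).2
  exact (h x x.2).imp (isUnit_mk_iff x.2).2 h1.2

theorem isLocalRing_toSubring (V : ValuationSubring L) : IsLocalRing V.toSubring :=
  inferInstanceAs (IsLocalRing V)

/-- Nonunits of an overring are nonunits of the smaller ring. -/
theorem nonunitSet_inter_subset {A B : Subring L} (h : A ≤ B) :
    nonunitSet B ∩ A ⊆ nonunitSet A := fun _ hx =>
  mem_nonunitSet_iff.2 ⟨hx.2, fun h0 hi => (mem_nonunitSet_iff.1 hx.1).2 h0 (h hi)⟩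

theorem nonunits_eq_nonunitSet (V : ValuationSubring L) :
    (V.nonunits : Set L) = nonunitSet V.toSubring := by
  ext x
  have h : x ∈ (V.nonunits : Set L) ↔ x = 0 ∨ x⁻¹ ∉ V := V.mem_nonunits_iff_or
  rw [h, mem_nonunitSet_iff]
  have := V.mem_or_inv_mem x
  have h0 : x = 0 → x ∈ V := fun h => h ▸ V.zero_mem
  simp only [ValuationSubring.mem_toSubring]
  tauto

end Nonunits

/-! ## Localizations -/

section Localization

variable {L : Type*} [Field L] {B : Subring L} (P : Ideal B)

theorem le_localizationAt : B ≤ localizationAt B P :=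
  fun _ hx => Subring.subset_closure (Or.inl hx)

theorem inv_mem_localizationAt {b : B} (hb : b ∉ P) : (b : L)⁻¹ ∈ localizationAt B P :=
  Subring.subset_closure (Or.inr ⟨b, hb, rfl⟩)

theorem coe_ne_zero {b : B} (hb : b ∉ P) : (b : L) ≠ 0 := by
  intro h
  apply hb
  rw [show b = 0 from Subtype.ext h]
  exact P.zero_mem

variable [hP : P.IsPrime]

theorem isLocalRing_localizationAt : IsLocalRing (localizationAt B P) := by
  refine isLocalRing_of_inv_mem fun x hx => ?_
  obtain ⟨a, b, hb, rfl⟩ := (mem_localizationAt B P x).1 hx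
  have hb0 := coe_ne_zero P hb
  by_cases ha : a ∈ P
  · right
    have hba : b - a ∉ P := fun h => hb (by simpa using P.add_mem h ha)
    have h0 := coe_ne_zero P hba
    have e : (1 - (a : L) / b) = ((b - a : B) : L) / b := by
      push_cast
      field_simp
    rw [e, inv_div]
    exact ⟨div_ne_zero h0 hb0, (mem_localizationAt B P _).2 ⟨b, b - a, hba, rfl⟩⟩
  · left
    rw [inv_div]
    exact ⟨div_ne_zero (coe_ne_zero P ha) hb0, (mem_localizationAt B P _).2 ⟨b, a, ha, rfl⟩⟩

theorem mem_nonunitSet_localizationAt {x : L} : x ∈ nonunitSet (localizationAt B P) ↔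
    ∃ a b : B, a ∈ P ∧ b ∉ P ∧ x = (a : L) / (b : L) := by
  constructor
  · intro hx
    obtain ⟨a, b, hb, rfl⟩ := (mem_localizationAt B P x).1 hx.1
    refine ⟨a, b, ?_, hb, rfl⟩
    by_contra ha
    refine notMem_nonunitSet (div_ne_zero (coe_ne_zero P ha) (coe_ne_zero P hb)) ?_ hx
    rw [inv_div]
    exact (mem_localizationAt B P _).2 ⟨b, a, ha, rfl⟩
  · rintro ⟨a, b, ha, hb, rfl⟩
    refine mem_nonunitSet_iff.2 ⟨(mem_localizationAt B P _).2 ⟨a, b, hb, rfl⟩, fun h0 h => ?_⟩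
    rw [inv_div] at h
    obtain ⟨c, d, hd, hcd⟩ := (mem_localizationAt B P _).1 h
    have ha0 : (a : L) ≠ 0 := fun h => h0 (by simp [h])
    rw [div_eq_div_iff ha0 (coe_ne_zero P hd)] at hcd
    have hcd' : b * d = c * a := Subtype.ext hcd
    exact (hP.mem_or_mem (hcd' ▸ P.mul_mem_left c ha)).elim hb hd

theorem coe_mem_nonunitSet_localizationAt {a : B} :
    (a : L) ∈ nonunitSet (localizationAt B P) ↔ a ∈ P := by
  constructor
  · intro h
    by_contra ha
    exact notMem_nonunitSet (coe_ne_zero P ha) (inv_mem_localizationAt P ha) h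
  · intro h
    exact (mem_nonunitSet_localizationAt P).2
      ⟨a, 1, h, fun h1 => hP.ne_top ((Ideal.eq_top_iff_one P).2 h1), by simp⟩

end Localization

/-! ## Maximal excluding domains -/

section MaximalExcluding

variable {F : Type*} [Field F]

/-- Zorn's lemma: the union of a chain of rings avoiding `x` still avoids `x`. Consequently every
subring is the intersection of the maximal excluding rings above it. -/
theorem exists_isMaximalExcluding {B : Subring F} {x : F} (hx : x ∉ B) :
    ∃ A, IsMaximalExcluding A ∧ B ≤ A ∧ x ∉ A := by
  obtain ⟨A, hBA, hA⟩ := zorn_le_nonempty₀ {A : Subring F | x ∉ A} (fun c hc hchain y hy =>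
    ⟨sSup c, fun h => by
      obtain ⟨s, hs, hxs⟩ := (Subring.mem_sSup_of_directedOn ⟨y, hy⟩ hchain.directedOn).1 h
      exact hc hs hxs, fun z hz => le_sSup hz⟩) B hx
  exact ⟨A, ⟨x, hA⟩, hBA, hA.1⟩

/-- For a nonzero nonunit `a` the ring `A[1/a]` is strictly larger than `A`, so by maximality it
contains `α`. -/
theorem IsMaximalExcluding.exists_pow_mul_mem {A : Subring F} {α : F}
    (hα : Maximal (fun B : Subring F => α ∉ B) A) {a : F} (ha : a ∈ A)
    (hu : ¬ (a ≠ 0 ∧ a⁻¹ ∈ A)) : ∃ n : ℕ, a ^ n * α ∈ A := by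
  by_cases h0 : a = 0
  · exact ⟨1, by simp [h0, A.zero_mem]⟩
  let B : Subring F :=
    { carrier := {x | ∃ n : ℕ, a ^ n * x ∈ A}
      zero_mem' := ⟨0, by simp [A.zero_mem]⟩
      one_mem' := ⟨0, by simp [A.one_mem]⟩
      neg_mem' := by
        rintro x ⟨n, hn⟩
        exact ⟨n, by simpa using A.neg_mem hn⟩
      mul_mem' := by
        rintro x y ⟨n, hn⟩ ⟨k, hk⟩
        exact ⟨n + k, by
          rw [show a ^ (n + k) * (x * y) = (a ^ n * x) * (a ^ k * y) by ring]
          exact A.mul_mem hn hk⟩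
      add_mem' := by
        rintro x y ⟨n, hn⟩ ⟨k, hk⟩
        exact ⟨n + k, by
          rw [show a ^ (n + k) * (x + y) = a ^ k * (a ^ n * x) + a ^ n * (a ^ k * y) by ring]
          exact A.add_mem (A.mul_mem (A.pow_mem ha k) hn) (A.mul_mem (A.pow_mem ha n) hk)⟩ }
  by_contra hn
  have hAB : A ≤ B := fun x hx => ⟨0, by simpa using hx⟩
  have hBA : B ≤ A := hα.2 (y := B) hn hAB
  exact hu ⟨h0, hBA ⟨1, by simp [h0, A.one_mem]⟩⟩

/-- If `a` and `1 - a` were both nonunits, powers of each would multiply `α` into `A`; these powers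
are comaximal, so `α` itself would lie in `A`. -/
theorem IsMaximalExcluding.isLocalRing {A : Subring F} (hA : IsMaximalExcluding A) :
    IsLocalRing A := by
  obtain ⟨α, hα⟩ := hA
  refine isLocalRing_of_inv_mem fun a ha => ?_
  by_contra! h
  have ha' : 1 - a ∈ A := A.sub_mem A.one_mem ha
  obtain ⟨n, hn⟩ := exists_pow_mul_mem hα ha fun hu => h.1 hu.1 hu.2
  obtain ⟨k, hk⟩ := exists_pow_mul_mem hα ha' fun hu => h.2 hu.1 hu.2
  have hcop : IsCoprime (⟨a, ha⟩ : A) ⟨1 - a, ha'⟩ := ⟨1, 1, Subtype.ext (by simp)⟩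
  obtain ⟨u, v, huv⟩ := hcop.pow (m := n) (n := k)
  have huv' : (u : F) * a ^ n + v * (1 - a) ^ k = 1 := by
    simpa using congrArg (Subtype.val) huv
  apply hα.1
  rw [← one_mul α, ← huv',
    show ((u : F) * a ^ n + v * (1 - a) ^ k) * α = u * (a ^ n * α) + v * ((1 - a) ^ k * α) by ring]
  exact A.add_mem (A.mul_mem u.2 hn) (A.mul_mem v.2 hk)

end MaximalExcluding

/-! ## Nagata rings -/

section Nagata

variable {F : Type*} [Field F]

theorem div_mem_nagataRing {A : Subring F} {f g : F[X]} (hf : ∀ i, f.coeff i ∈ A)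
    (hg : ∀ i, g.coeff i ∈ A) {k : ℕ} (h0 : g.coeff k ≠ 0) (hk : (g.coeff k)⁻¹ ∈ A) :
    algebraMap F[X] (RatFunc F) f / algebraMap F[X] (RatFunc F) g ∈ nagataRing A := by
  have lift : ∀ p : F[X], (∀ i, p.coeff i ∈ A) → ∃ q : A[X], q.map A.subtype = p := fun p hp =>
    (Polynomial.mem_lifts p).1 ((Polynomial.lifts_iff_coeff_lifts p).2 fun i => ⟨⟨_, hp i⟩, rfl⟩)
  obtain ⟨f', rfl⟩ := lift f hf
  obtain ⟨g', rfl⟩ := lift g hg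
  refine ⟨f', g', ?_, rfl⟩
  refine Ideal.eq_top_of_isUnit_mem _ (coeff_mem_contentIdeal g' k) ?_
  exact (isUnit_mk_iff (g'.coeff k).2).2 ⟨by simpa using h0, by simpa using hk⟩

/-- Over a local ring a unit content ideal means that some coefficient is a unit; otherwise all of
them lie in the maximal ideal. -/
theorem exists_of_mem_nagataRing {A : Subring F} [IsLocalRing A] {φ : RatFunc F}
    (hφ : φ ∈ nagataRing A) : ∃ f g : F[X], (∀ i, f.coeff i ∈ A) ∧ (∀ i, g.coeff i ∈ A) ∧
      (∃ k, g.coeff k ≠ 0 ∧ (g.coeff k)⁻¹ ∈ A) ∧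
      φ = algebraMap F[X] (RatFunc F) f / algebraMap F[X] (RatFunc F) g := by
  obtain ⟨f, g, hg, rfl⟩ := hφ
  refine ⟨_, _, fun i => by simp, fun i => by simp, ?_, rfl⟩
  by_contra! h
  have : g.contentIdeal ≤ IsLocalRing.maximalIdeal A := by
    rw [contentIdeal_def, Ideal.span_le]
    intro x hx
    obtain ⟨k, -, rfl⟩ := mem_coeffs_iff.1 hx
    refine mem_maximalIdeal_iff.2 (mem_nonunitSet_iff.2 ⟨(g.coeff k).2, fun h0 => ?_⟩)
    simpa using h k (by simpa using h0)
  exact (IsLocalRing.maximalIdeal.isMaximal A).ne_top (top_unique (hg ▸ this))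

theorem nagataRing_mono {A B : Subring F} (h : A ≤ B) : nagataRing A ≤ nagataRing B := by
  rintro _ ⟨f, g, hg, rfl⟩
  refine ⟨f.map (Subring.inclusion h), g.map (Subring.inclusion h), ?_, ?_⟩
  · rw [contentIdeal_map_eq_map_contentIdeal, hg, Ideal.map_top]
  · rw [Polynomial.map_map, Polynomial.map_map]
    rfl

theorem algebraMap_mem_nagataRing {A : Subring F} {f : F[X]} (hf : ∀ i, f.coeff i ∈ A) :
    algebraMap F[X] (RatFunc F) f ∈ nagataRing A := by
  have h := div_mem_nagataRing (A := A) (f := f) (g := 1) hf (fun i => by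
    rw [coeff_one]; split_ifs <;> simp) (k := 0) (by simp) (by simp)
  simpa using h

theorem C_mem_nagataRing {A : Subring F} {a : F} (ha : a ∈ A) :
    RatFunc.C a ∈ nagataRing A := by
  rw [← RatFunc.algebraMap_C]
  refine algebraMap_mem_nagataRing fun i => ?_
  rw [coeff_C]
  split_ifs <;> simp [ha]

theorem algebraMap_ne_zero_of_coeff {g : F[X]} {k : ℕ} (h : g.coeff k ≠ 0) :
    algebraMap F[X] (RatFunc F) g ≠ 0 := by
  refine RatFunc.algebraMap_ne_zero fun h0 => h ?_
  simp [h0]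

/-- The Nagata ring of a local ring is local. -/
theorem isLocalRing_nagataRing (A : Subring F) [IsLocalRing A] :
    IsLocalRing (nagataRing A) := by
  refine isLocalRing_of_inv_mem fun φ hφ => ?_
  obtain ⟨f, g, hf, hg, ⟨k, hk0, hk⟩, rfl⟩ := exists_of_mem_nagataRing hφ
  have hg0 := algebraMap_ne_zero_of_coeff hk0
  by_cases hfk : f.coeff k ∈ nonunitSet A
  · right
    have hgk : (g - f).coeff k ∉ nonunitSet A := by
      rw [coeff_sub, sub_eq_add_neg]
      exact add_notMem_nonunitSet (notMem_nonunitSet hk0 hk) (neg_mem_nonunitSet hfk)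
    have hgf : ∀ i, (g - f).coeff i ∈ A := fun i => by
      rw [coeff_sub]
      exact A.sub_mem (hg i) (hf i)
    obtain ⟨h1, h2⟩ := ne_zero_and_inv_mem (hgf k) hgk
    have e : 1 - algebraMap F[X] (RatFunc F) f / algebraMap F[X] (RatFunc F) g =
        algebraMap F[X] (RatFunc F) (g - f) / algebraMap F[X] (RatFunc F) g := by
      rw [map_sub, sub_div, div_self hg0]
    rw [e, inv_div]
    exact ⟨div_ne_zero (algebraMap_ne_zero_of_coeff h1) hg0, div_mem_nagataRing hg hgf h1 h2⟩
  · left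
    obtain ⟨h1, h2⟩ := ne_zero_and_inv_mem (hf k) hfk
    rw [inv_div]
    exact ⟨div_ne_zero (algebraMap_ne_zero_of_coeff h1) hg0, div_mem_nagataRing hg hf h1 h2⟩

theorem C_mem_nonunitSet_nagataRing {A : Subring F} [IsLocalRing A] {a : F}
    (ha : a ∈ nonunitSet A) : RatFunc.C a ∈ nonunitSet (nagataRing A) := by
  refine mem_nonunitSet_iff.2 ⟨C_mem_nagataRing ha.1, fun h0 h => ?_⟩
  obtain ⟨f, g, hf, hg, ⟨k, hk0, hk⟩, e⟩ := exists_of_mem_nagataRing h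
  have hg0 := algebraMap_ne_zero_of_coeff hk0
  rw [inv_eq_iff_eq_inv, inv_div, eq_div_iff_mul_eq (by
    intro hf0
    rw [hf0, div_zero] at e
    exact h0 e), ← RatFunc.algebraMap_C, ← map_mul] at e
  have e' := congrArg (fun p : F[X] => p.coeff k) (RatFunc.algebraMap_injective F e)
  simp only [coeff_C_mul] at e'
  refine notMem_nonunitSet hk0 hk ?_
  rw [← e', mul_comm]
  exact mul_mem_nonunitSet (hf k) ha

/-- A polynomial in the Nagata ring of a local ring `A` has coefficients in `A`. -/
theorem coeff_mem_of_mul_coeff_mem {A : Subring F} [IsLocalRing A] {h g : F[X]}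
    (hg : ∀ i, g.coeff i ∈ A) (hk : ∃ k, g.coeff k ≠ 0 ∧ (g.coeff k)⁻¹ ∈ A)
    (hhg : ∀ i, (h * g).coeff i ∈ A) (i : ℕ) : h.coeff i ∈ A := by
  classical
  -- The lowest unit coefficient of `g` is chosen so that, in the coefficient of `h * g` at `j + k`,
  -- the terms with `h`-index above `j` carry a nonunit of `A`, while those with index below `j` are
  -- covered by induction.
  obtain ⟨k, ⟨hk0, hkA⟩, hmin⟩ : ∃ k, (g.coeff k ≠ 0 ∧ (g.coeff k)⁻¹ ∈ A) ∧
      ∀ j < k, g.coeff j ∈ nonunitSet A := by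
    refine ⟨Nat.find hk, Nat.find_spec hk, fun j hj => ?_⟩
    by_contra hn
    exact Nat.find_min hk hj (ne_zero_and_inv_mem (hg j) hn)
  let N : Submodule A F := Submodule.span A (h.coeffs : Set F)
  let M : Submodule A F := 1
  have hN : ∀ i, h.coeff i ∈ N := fun i => by
    by_cases h0 : h.coeff i = 0
    · rw [h0]
      exact N.zero_mem
    · exact Submodule.subset_span (coeff_mem_coeffs h0)
  have hM : ∀ x : F, x ∈ A → x ∈ M := fun x hx => Submodule.mem_one.2 ⟨⟨x, hx⟩, rfl⟩
  let T := M ⊔ IsLocalRing.maximalIdeal A • N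
  have hsmul : ∀ a ∈ A, ∀ x ∈ T, x * a ∈ T := fun a ha x hx => by
    have := T.smul_mem (⟨a, ha⟩ : A) hx
    rwa [Subring.smul_def, smul_eq_mul, mul_comm] at this
  have key : ∀ j, h.coeff j ∈ T := by
    intro j
    induction j using Nat.strong_induction_on with
    | _ j ih =>
      have e := coeff_mul h g (j + k)
      rw [← Finset.add_sum_erase _ _ (show (j, k) ∈ Finset.HasAntidiagonal.antidiagonal (j + k) by simp)] at e
      have hsum : ∑ x ∈ (Finset.HasAntidiagonal.antidiagonal (j + k)).erase (j, k),
          h.coeff x.1 * g.coeff x.2 ∈ T := by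
        refine T.sum_mem fun x hx => ?_
        obtain ⟨hne, hx⟩ := Finset.mem_erase.1 hx
        rw [Finset.HasAntidiagonal.mem_antidiagonal] at hx
        rcases lt_trichotomy x.1 j with h1 | h1 | h1
        · exact hsmul _ (hg _) _ (ih _ h1)
        · exact absurd (Prod.ext h1 (by simp; omega)) hne
        · refine Submodule.mem_sup_right ?_
          have hm := mem_maximalIdeal_iff (x := ⟨g.coeff x.2, hg x.2⟩).2 (hmin x.2 (by omega))
          have := Submodule.smul_mem_smul hm (hN x.1)
          rwa [Subring.smul_def, smul_eq_mul, mul_comm] at this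
      have h2 : h.coeff j * g.coeff k ∈ T := by
        rw [show h.coeff j * g.coeff k = _ from eq_sub_of_add_eq e.symm]
        exact T.sub_mem (Submodule.mem_sup_left (hM _ (hhg _))) hsum
      have h3 := hsmul _ hkA _ h2
      rwa [mul_assoc, mul_inv_cancel₀ hk0, mul_one] at h3
  have hle : N ≤ T := Submodule.span_le.2 fun x hx => by
    obtain ⟨j, -, rfl⟩ := mem_coeffs_iff.1 hx
    exact key j
  -- Nakayama: the finitely generated module `N` satisfies `N ⊆ A + 𝔪_A N`, hence `N ⊆ A`.
  have hNM : N ≤ M := Submodule.le_of_le_smul_of_le_jacobson_bot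
    (Submodule.fg_span (Finset.finite_toSet _)) (IsLocalRing.maximalIdeal_le_jacobson _) hle
  obtain ⟨y, hy⟩ := Submodule.mem_one.1 (hNM (hN i))
  rw [← hy]
  exact y.2

theorem coeff_mem_of_algebraMap_mem_nagataRing {A : Subring F} [IsLocalRing A] {h : F[X]}
    (hh : algebraMap F[X] (RatFunc F) h ∈ nagataRing A) (i : ℕ) : h.coeff i ∈ A := by
  obtain ⟨f, g, hf, hg, hk, e⟩ := exists_of_mem_nagataRing hh
  have hg0 : algebraMap F[X] (RatFunc F) g ≠ 0 := algebraMap_ne_zero_of_coeff hk.choose_spec.1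
  rw [eq_div_iff hg0, ← map_mul] at e
  have e' := RatFunc.algebraMap_injective F e
  exact coeff_mem_of_mul_coeff_mem hg hk (fun i => e' ▸ hf i) i

/-- Every nonzero polynomial has a coefficient dividing all the others in a given valuation
ring. -/
theorem exists_coeff_div_mem (V : ValuationSubring F) {g : F[X]} (hg : g ≠ 0) :
    ∃ k, g.coeff k ≠ 0 ∧ ∀ i, g.coeff i / g.coeff k ∈ V := by
  obtain ⟨k, hk, hmax⟩ := Finset.exists_max_image g.support (fun i => V.valuation (g.coeff i))
    (Polynomial.nonempty_support_iff.2 hg)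
  have hk0 := Polynomial.mem_support_iff.1 hk
  refine ⟨k, hk0, fun i => ?_⟩
  by_cases hi : g.coeff i = 0
  · simp [hi, V.zero_mem]
  rw [← V.valuation_le_one_iff, map_div₀]
  exact div_le_one_of_le₀ (hmax i (Polynomial.mem_support_iff.2 hi)) zero_le

/-- Over a valuation ring, numerator and denominator are scalars times primitive polynomials, so the
ratio of the two scalars decides. -/
theorem mem_or_inv_mem_nagataRing (V : ValuationSubring F) (φ : RatFunc F) :
    φ ∈ nagataRing V.toSubring ∨ φ⁻¹ ∈ nagataRing V.toSubring := by
  by_cases hφ : φ = 0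
  · exact Or.inl (hφ ▸ Subring.zero_mem _)
  obtain ⟨f, g, hg, rfl⟩ := IsFractionRing.div_surjective (A := F[X]) φ
  have hg0 : g ≠ 0 := nonZeroDivisors.ne_zero hg
  have hf0 : f ≠ 0 := by
    rintro rfl
    simp at hφ
  have main : ∀ {f g : F[X]} {k l : ℕ}, g.coeff k ≠ 0 → (∀ i, g.coeff i / g.coeff k ∈ V) →
      (∀ i, f.coeff i / f.coeff l ∈ V) → f.coeff l ≠ 0 → f.coeff l / g.coeff k ∈ V →
      algebraMap F[X] (RatFunc F) f / algebraMap F[X] (RatFunc F) g ∈ nagataRing V.toSubring := by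
    intro f g k l hk hgk hfl hl hlk
    have hc : algebraMap F[X] (RatFunc F) (C (g.coeff k)⁻¹) ≠ 0 :=
      RatFunc.algebraMap_ne_zero (by simpa using hk)
    rw [← mul_div_mul_left _ _ hc, ← map_mul, ← map_mul]
    refine div_mem_nagataRing (k := k) (fun i => ?_) (fun i => ?_) ?_ ?_
    · rw [coeff_C_mul, show (g.coeff k)⁻¹ * f.coeff i =
        (f.coeff i / f.coeff l) * (f.coeff l / g.coeff k) by field_simp]
      exact V.mul_mem _ _ (hfl i) hlk
    · rw [coeff_C_mul, mul_comm, ← div_eq_mul_inv]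
      exact hgk i
    · rw [coeff_C_mul, inv_mul_cancel₀ hk]
      exact one_ne_zero
    · rw [coeff_C_mul, inv_mul_cancel₀ hk, inv_one]
      exact V.one_mem
  obtain ⟨k, hk, hgk⟩ := exists_coeff_div_mem V hg0
  obtain ⟨l, hl, hfl⟩ := exists_coeff_div_mem V hf0
  rcases V.mem_or_inv_mem (f.coeff l / g.coeff k) with h | h
  · exact Or.inl (main hk hgk hfl hl h)
  · rw [inv_div] at h ⊢
    exact Or.inr (main hl hfl hgk hk h)

end Nagata

/-! ## The rings `A_V` -/

section RingA

variable {F' F : Type*} [Field F'] [Field F] [Algebra F' F]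

/-- Valuation rings are integrally closed. The base ring enters through a homomorphism, so that it
may live in another field, as `D'` does. -/
theorem mem_of_isIntegralElem {R L : Type*} [CommRing R] [Field L] (W : ValuationSubring L)
    (f : R →+* L) (hf : ∀ r, f r ∈ W) {x : L} (hx : f.IsIntegralElem x) : x ∈ W := by
  obtain ⟨p, hp, hpx⟩ := hx
  have : IsIntegral W x := ⟨p.map (f.codRestrict W.toSubring hf), hp.map _, by
    rw [eval₂_map]
    exact hpx⟩
  obtain ⟨y, rfl⟩ := IsIntegrallyClosed.isIntegral_iff.1 this
  exact y.2

/-- The ideal `(𝔪_V, 𝔪_D)` of `V[𝔪_D]`. -/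
def idealA (D : Subring F) (V : ValuationSubring F') :
    Ideal (adjoin (V.toSubring.map (algebraMap F' F)) (nonunitSet D)) :=
  Ideal.span {x | (x : F) ∈ algebraMap F' F '' nonunitSet V.toSubring ∪ nonunitSet D}

/-- A subring `L` of `F` dominates `D` and `V`. -/
structure Dominates (L : Subring F) (D : Subring F) (V : ValuationSubring F') : Prop where
  le : V.toSubring.map (algebraMap F' F) ≤ L
  nonunit_base : ∀ a ∈ nonunitSet V.toSubring, algebraMap F' F a ∈ nonunitSet L
  nonunit : nonunitSet D ⊆ nonunitSet L

variable {D : Subring F} {V : ValuationSubring F'} {L : Subring F}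

theorem Dominates.adjoin_le (h : Dominates L D V) :
    adjoin (V.toSubring.map (algebraMap F' F)) (nonunitSet D) ≤ L := by
  refine Subring.closure_le.2 ?_
  rintro x (hx | hx)
  · exact h.le hx
  · exact (h.nonunit hx).1

theorem Dominates.coe_mem [IsLocalRing L] (h : Dominates L D V) {x} (hx : x ∈ idealA D V) :
    (x : F) ∈ nonunitSet L := by
  have : idealA D V ≤ (IsLocalRing.maximalIdeal L).comap (Subring.inclusion h.adjoin_le) := by
    refine Ideal.span_le.2 ?_
    intro y hy
    refine mem_maximalIdeal_iff.2 ?_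
    rcases hy with ⟨a, ha, hay⟩ | hy
    · change (y : F) ∈ _
      rw [← hay]
      exact h.nonunit_base a ha
    · exact h.nonunit hy
  exact mem_maximalIdeal_iff.1 (this hx)

/-- The sums `V + (𝔪_V, 𝔪_D)` already form a ring containing all the generators. -/
theorem exists_add_of_mem_adjoin
    (b : adjoin (V.toSubring.map (algebraMap F' F)) (nonunitSet D)) :
    ∃ v ∈ V, ∃ m ∈ idealA D V, (b : F) = algebraMap F' F v + m := by
  have hV : ∀ v ∈ V, algebraMap F' F v ∈
      adjoin (V.toSubring.map (algebraMap F' F)) (nonunitSet D) := fun v hv =>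
    Subring.subset_closure (Or.inl ⟨v, hv, rfl⟩)
  obtain ⟨b, hb⟩ := b
  refine Subring.closure_induction
    (p := fun x _ => ∃ v ∈ V, ∃ m ∈ idealA D V, x = algebraMap F' F v + m) ?_ ?_ ?_ ?_ ?_ ?_ hb
  · rintro x (⟨v, hv, rfl⟩ | hx)
    · exact ⟨v, hv, 0, zero_mem _, by simp⟩
    · exact ⟨0, V.zero_mem, ⟨x, Subring.subset_closure (Or.inr hx)⟩,
        Ideal.subset_span (Or.inr hx), by simp⟩
  · exact ⟨0, V.zero_mem, 0, zero_mem _, by simp⟩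
  · exact ⟨1, V.one_mem, 0, zero_mem _, by simp⟩
  · rintro x y _ _ ⟨v, hv, m, hm, rfl⟩ ⟨w, hw, n, hn, rfl⟩
    exact ⟨v + w, V.add_mem _ _ hv hw, m + n, add_mem hm hn, by push_cast; ring⟩
  · rintro x _ ⟨v, hv, m, hm, rfl⟩
    exact ⟨-v, V.neg_mem _ hv, -m, neg_mem hm, by push_cast; ring⟩
  · rintro x y _ _ ⟨v, hv, m, hm, rfl⟩ ⟨w, hw, n, hn, rfl⟩
    refine ⟨v * w, V.mul_mem _ _ hv hw,
      ⟨_, hV v hv⟩ * n + ⟨_, hV w hw⟩ * m + m * n, ?_, by push_cast; ring⟩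
    exact add_mem (add_mem (Ideal.mul_mem_left _ _ hn) (Ideal.mul_mem_left _ _ hm))
      (Ideal.mul_mem_left _ _ hn)

theorem base_mem_idealA {v : F'} (hv : v ∈ nonunitSet V.toSubring)
    (h : algebraMap F' F v ∈ adjoin (V.toSubring.map (algebraMap F' F)) (nonunitSet D)) :
    (⟨_, h⟩ : adjoin (V.toSubring.map (algebraMap F' F)) (nonunitSet D)) ∈ idealA D V :=
  Ideal.subset_span (Or.inl ⟨v, hv, rfl⟩)

/-- An element of `V[𝔪_D]` outside `(𝔪_V, 𝔪_D)` is the sum of a unit of `V` and an element of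
`(𝔪_V, 𝔪_D)`. -/
theorem exists_unit_add_of_notMem
    {b : adjoin (V.toSubring.map (algebraMap F' F)) (nonunitSet D)} (hb : b ∉ idealA D V) :
    ∃ v ∈ V, v ≠ 0 ∧ v⁻¹ ∈ V ∧ ∃ m ∈ idealA D V, (b : F) = algebraMap F' F v + m := by
  obtain ⟨v, hv, m, hm, e⟩ := exists_add_of_mem_adjoin b
  have hvm : v ∉ nonunitSet V.toSubring := fun hn => hb <| by
    have hv' : algebraMap F' F v ∈ adjoin (V.toSubring.map (algebraMap F' F)) (nonunitSet D) :=
      Subring.subset_closure (Or.inl ⟨v, hv, rfl⟩)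
    rw [show b = ⟨_, hv'⟩ + m from Subtype.ext e]
    exact add_mem (base_mem_idealA hn hv') hm
  obtain ⟨h1, h2⟩ := ne_zero_and_inv_mem (B := V.toSubring) hv hvm
  exact ⟨v, hv, h1, h2, m, hm, e⟩

theorem Dominates.notMem_nonunitSet [IsLocalRing L] (h : Dominates L D V)
    {b : adjoin (V.toSubring.map (algebraMap F' F)) (nonunitSet D)} (hb : b ∉ idealA D V) :
    (b : F) ∉ nonunitSet L := by
  obtain ⟨v, -, h0, hvi, m, hm, e⟩ := exists_unit_add_of_notMem hb
  rw [e]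
  refine add_notMem_nonunitSet (KrRing.notMem_nonunitSet (by simpa using h0) ?_) (h.coe_mem hm)
  exact h.le ⟨_, hvi, map_inv₀ _ _⟩

/-- The ideal is proper because it lands in `𝔪_L`, and maximal because elements outside it are units
of `V` modulo it. The ring `L` serves only as a witness of properness. -/
theorem Dominates.idealA_isPrime [IsLocalRing L] (h : Dominates L D V) :
    (idealA D V).IsPrime := by
  have hmax : (idealA D V).IsMaximal := by
    refine Ideal.isMaximal_iff.2 ⟨fun h1 => one_notMem_nonunitSet (h.coe_mem h1), ?_⟩
    intro J b hJ hb hbJ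
    obtain ⟨v, hv, h0, hvi, m, hm, e⟩ := exists_unit_add_of_notMem hb
    have hv' : algebraMap F' F v⁻¹ ∈ adjoin (V.toSubring.map (algebraMap F' F)) (nonunitSet D) :=
      Subring.subset_closure (Or.inl ⟨_, hvi, rfl⟩)
    have h0' : algebraMap F' F v ≠ 0 := by simpa using h0
    rw [show (1 : adjoin (V.toSubring.map (algebraMap F' F)) (nonunitSet D)) =
      ⟨_, hv'⟩ * (b - m) from Subtype.ext (by
        change (1 : F) = algebraMap F' F v⁻¹ * ((b : F) - m)
        rw [e, map_inv₀, add_sub_cancel_right, inv_mul_cancel₀ h0'])]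
    exact J.mul_mem_left _ (J.sub_mem hbJ (hJ hm))
  exact hmax.isPrime

/-- Elements of `V[𝔪_D]` outside `(𝔪_V, 𝔪_D)` are units in any local ring dominating `V` and `D`, so
`A_V` is the smallest such ring. -/
theorem Dominates.ringA_le [IsLocalRing L] (h : Dominates L D V) : ringA D V ≤ L := by
  refine Subring.closure_le.2 ?_
  rintro x (hx | ⟨b, hb, rfl⟩)
  · exact h.adjoin_le hx
  · exact (ne_zero_and_inv_mem (h.adjoin_le b.2) (h.notMem_nonunitSet hb)).2

theorem Dominates.nonunitSet_ringA_subset [IsLocalRing L] (h : Dominates L D V) :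
    nonunitSet (ringA D V) ⊆ nonunitSet L := by
  have := h.idealA_isPrime
  intro x hx
  obtain ⟨a, b, ha, hb, rfl⟩ := (mem_nonunitSet_localizationAt (idealA D V)).1 hx
  rw [div_eq_mul_inv, mul_comm]
  exact mul_mem_nonunitSet (h.ringA_le (inv_mem_localizationAt _ hb)) (h.coe_mem ha)

theorem Dominates.isLocalRing_ringA [IsLocalRing L] (h : Dominates L D V) :
    IsLocalRing (ringA D V) :=
  have := h.idealA_isPrime
  isLocalRing_localizationAt (idealA D V)

theorem map_le_ringA : V.toSubring.map (algebraMap F' F) ≤ ringA D V :=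
  fun _ hx => le_localizationAt _ (Subring.subset_closure (Or.inl hx))

theorem Dominates.dominates_ringA [IsLocalRing L] (h : Dominates L D V) :
    Dominates (ringA D V) D V := by
  have := h.idealA_isPrime
  refine ⟨map_le_ringA, fun a ha => ?_, fun x hx => ?_⟩
  · have ha' : algebraMap F' F a ∈ adjoin (V.toSubring.map (algebraMap F' F)) (nonunitSet D) :=
      Subring.subset_closure (Or.inl ⟨_, ha.1, rfl⟩)
    exact (coe_mem_nonunitSet_localizationAt (idealA D V)).2 (base_mem_idealA ha ha')
  · exact (coe_mem_nonunitSet_localizationAt (idealA D V)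
      (a := ⟨x, Subring.subset_closure (Or.inr hx)⟩)).2 (Ideal.subset_span (Or.inr hx))

/-- The residue field of `A_V` is that of `V`. -/
theorem Dominates.exists_add_of_mem_ringA [IsLocalRing L] (h : Dominates L D V) {x : F}
    (hx : x ∈ ringA D V) : ∃ v ∈ V, ∃ m ∈ nonunitSet (ringA D V), x = algebraMap F' F v + m := by
  have := h.idealA_isPrime
  have := h.isLocalRing_ringA
  obtain ⟨a, b, hb, rfl⟩ := (mem_localizationAt _ (idealA D V) x).1 hx
  obtain ⟨v, hv, m, hm, ea⟩ := exists_add_of_mem_adjoin a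
  obtain ⟨u, hu, h0, hui, n, hn, eb⟩ := exists_unit_add_of_notMem hb
  have h0' : algebraMap F' F u ≠ 0 := by simpa using h0
  have hb0 := coe_ne_zero _ hb
  have hbi : (b : F)⁻¹ ∈ ringA D V := inv_mem_localizationAt _ hb
  have hmem : ∀ w ∈ V, algebraMap F' F w ∈ ringA D V := fun w hw => map_le_ringA ⟨w, hw, rfl⟩
  have hI : ∀ y ∈ idealA D V, (y : F) ∈ nonunitSet (ringA D V) := fun y hy =>
    (coe_mem_nonunitSet_localizationAt (idealA D V)).2 hy
  -- With `a = v + m` and `b = u + n`, this is `a/b - v/u = (m - (v/u) n)/b`.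
  refine ⟨v * u⁻¹, V.mul_mem _ _ hv hui,
    (b : F)⁻¹ * m + (b : F)⁻¹ * algebraMap F' F (v * u⁻¹) * (-n), ?_, ?_⟩
  · exact add_mem_nonunitSet (mul_mem_nonunitSet hbi (hI m hm))
      (mul_mem_nonunitSet (Subring.mul_mem _ hbi (hmem _ (V.mul_mem _ _ hv hui)))
        (neg_mem_nonunitSet (hI n hn)))
  · rw [div_eq_iff hb0, map_mul, map_inv₀, ea]
    field_simp
    rw [eb]
    ring

/-- Every valuation ring of `F'` has an extension to `F`. -/
theorem exists_valuationSubring_extension (V : ValuationSubring F') :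
    ∃ W : ValuationSubring F, V.toSubring.map (algebraMap F' F) ≤ W.toSubring ∧
      ∀ a ∈ nonunitSet V.toSubring, algebraMap F' F a ∈ nonunitSet W.toSubring := by
  have := isLocalRing_toSubring V
  obtain ⟨W, h, hW⟩ := IsLocalRing.exists_factor_valuationRing
    ((algebraMap F' F).comp V.toSubring.subtype)
  refine ⟨W, ?_, fun a ha => ⟨h ⟨a, ha.1⟩, fun hu => ha.2 ?_⟩⟩
  · rintro _ ⟨v, hv, rfl⟩
    exact h ⟨v, hv⟩
  · exact hW.1 _ hu

/-- Valuation rings above `D` and centered over the maximal ideal of `D'` are centered on the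
maximal ideal of the integral extension `D` of `D'`. -/
theorem nonunitSet_subset_of_isIntegral {D' : Subring F'} [IsLocalRing D'] [IsLocalRing D]
    (hle : D'.map (algebraMap F' F) ≤ D) (hint : ∀ x ∈ D, IsIntegral D' x)
    {W : ValuationSubring F} (hW : D ≤ W.toSubring)
    (hmW : ∀ a ∈ nonunitSet D', algebraMap F' F a ∈ nonunitSet W.toSubring) :
    nonunitSet D ⊆ nonunitSet W.toSubring := by
  have := isLocalRing_toSubring W
  let f : D' →+* D := ((algebraMap F' F).comp D'.subtype).codRestrict D
    fun x => hle ⟨x, x.2, rfl⟩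
  have hf : f.IsIntegral := fun x => by
    obtain ⟨p, hp, hpx⟩ := hint x x.2
    refine ⟨p, hp, Subtype.ext ?_⟩
    have := hom_eval₂ p f D.subtype x
    exact this.trans hpx
  let P : Ideal D := (IsLocalRing.maximalIdeal W.toSubring).comap (Subring.inclusion hW)
  have hP : P.IsPrime := Ideal.comap_isPrime _ _
  have hcomap : P.comap f = IsLocalRing.maximalIdeal D' := by
    refine ((IsLocalRing.maximalIdeal.isMaximal D').eq_of_le
      (Ideal.comap_isPrime f P).ne_top fun a ha => ?_).symm
    exact mem_maximalIdeal_iff.2 (hmW a (mem_maximalIdeal_iff.1 ha))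
  -- In an integral extension, a prime lying over a maximal ideal is maximal.
  have hPmax : P.IsMaximal := Ideal.isMaximal_of_isIntegral_of_isMaximal_comap' f hf P
    (hcomap ▸ IsLocalRing.maximalIdeal.isMaximal D')
  intro x hx
  have h1 : (⟨x, hx.1⟩ : D) ∈ P := by
    rw [IsLocalRing.eq_maximalIdeal hPmax]
    exact mem_maximalIdeal_iff.2 hx
  exact mem_maximalIdeal_iff.1 (Ideal.mem_comap.1 h1)

/-- For every `V` dominating `D'`, the ring `A_V` dominates `V` and `D`. -/
theorem dominates_ringA_of_mem {D' : Subring F'} [IsLocalRing D'] [IsLocalRing D]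
    (hle : D'.map (algebraMap F' F) ≤ D) (hint : ∀ x ∈ D, IsIntegral D' x)
    (hV : V ∈ dominatingValuations D') :
    Dominates (ringA D V) D V ∧ IsLocalRing (ringA D V) := by
  -- An extension of `V` to `F` contains `D` by integrality and provides the local ring that
  -- dominates both `V` and `D`.
  obtain ⟨W, hVW, hmW⟩ := exists_valuationSubring_extension (F := F) V
  have := isLocalRing_toSubring W
  have hDW : D ≤ W.toSubring := fun x hx =>
    mem_of_isIntegralElem W (algebraMap D' F) (fun r => hVW ⟨r, hV.1 r.2, rfl⟩) (hint x hx)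
  have hW : Dominates W.toSubring D V := ⟨hVW, hmW,
    nonunitSet_subset_of_isIntegral hle hint hDW fun a ha => hmW a (hV.2 ha)⟩
  exact ⟨hW.dominates_ringA, hW.isLocalRing_ringA⟩

/-- Below every valuation ring above the local ring `D` there is one that dominates `D`. -/
theorem exists_le_dominating [IsLocalRing D] {W : ValuationSubring F} (hW : D ≤ W.toSubring) :
    ∃ W₁ ≤ W, D ≤ W₁.toSubring ∧ nonunitSet D ⊆ nonunitSet W₁.toSubring := by
  have := isLocalRing_toSubring W
  let M := nonunitSet W.toSubring
  -- `W₁` is obtained from `B = D + 𝔪_W` by dominating its ideal `J = 𝔪_D + 𝔪_W`. Keeping `𝔪_W`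
  -- inside `𝔪_{W₁}` is what gives `W₁ ⊆ W`.
  let B : Subring F :=
    { carrier := {x | ∃ d ∈ D, ∃ m ∈ M, x = d + m}
      zero_mem' := ⟨0, D.zero_mem, 0, zero_mem_nonunitSet, by simp⟩
      one_mem' := ⟨1, D.one_mem, 0, zero_mem_nonunitSet, by simp⟩
      neg_mem' := by
        rintro _ ⟨d, hd, m, hm, rfl⟩
        exact ⟨-d, D.neg_mem hd, -m, neg_mem_nonunitSet hm, by ring⟩
      add_mem' := by
        rintro _ _ ⟨d, hd, m, hm, rfl⟩ ⟨e, he, n, hn, rfl⟩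
        exact ⟨d + e, D.add_mem hd he, m + n, add_mem_nonunitSet hm hn, by ring⟩
      mul_mem' := by
        rintro _ _ ⟨d, hd, m, hm, rfl⟩ ⟨e, he, n, hn, rfl⟩
        exact ⟨d * e, D.mul_mem hd he, d * n + e * m + m * n, add_mem_nonunitSet
          (add_mem_nonunitSet (mul_mem_nonunitSet (hW hd) hn) (mul_mem_nonunitSet (hW he) hm))
          (mul_mem_nonunitSet hm.1 hn), by ring⟩ }
  let J : Ideal B :=
    { carrier := {x | ∃ d ∈ nonunitSet D, ∃ m ∈ M, (x : F) = d + m}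
      zero_mem' := ⟨0, zero_mem_nonunitSet, 0, zero_mem_nonunitSet, by simp⟩
      add_mem' := by
        rintro x y ⟨d, hd, m, hm, hx⟩ ⟨e, he, n, hn, hy⟩
        exact ⟨d + e, add_mem_nonunitSet hd he, m + n, add_mem_nonunitSet hm hn, by
          push_cast
          rw [hx, hy]
          ring⟩
      smul_mem' := by
        rintro ⟨_, d, hd, m, hm, rfl⟩ x ⟨e, he, n, hn, hx⟩
        refine ⟨d * e, mul_mem_nonunitSet hd he, d * n + e * m + m * n, add_mem_nonunitSet
          (add_mem_nonunitSet (mul_mem_nonunitSet (hW hd) hn)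
            (mul_mem_nonunitSet (hW he.1) hm)) (mul_mem_nonunitSet hm.1 hn), ?_⟩
        rw [smul_eq_mul, Subring.coe_mul, hx]
        ring }
  -- If `1 = d + m`, then `m = 1 - d` is a unit of `D`, hence of `W`.
  have hJ : J ≠ ⊤ := fun h => by
    obtain ⟨d, hd, m, hm, e⟩ := (Ideal.eq_top_iff_one J).1 h
    have h1 : (1 : F) = d + m := e
    have hu : (1 - d) ∉ nonunitSet D := by
      rw [sub_eq_add_neg]
      exact add_notMem_nonunitSet one_notMem_nonunitSet (neg_mem_nonunitSet hd)
    obtain ⟨h2, h3⟩ := ne_zero_and_inv_mem (D.sub_mem D.one_mem hd.1) hu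
    rw [h1, add_sub_cancel_left] at h2 h3
    exact notMem_nonunitSet h2 (hW h3) hm
  obtain ⟨W₁, h1, h2⟩ := Ideal.image_subset_nonunits_valuationSubring J hJ
  rw [nonunits_eq_nonunitSet] at h2
  have hM : M ⊆ nonunitSet W₁.toSubring := fun m hm =>
    h2 ⟨⟨m, 0, D.zero_mem, m, hm, by simp⟩, ⟨0, zero_mem_nonunitSet, m, hm, by simp⟩, rfl⟩
  refine ⟨W₁, fun x hx => ?_, fun d hd => h1 ⟨d, hd, 0, zero_mem_nonunitSet, by simp⟩,
    fun d hd => h2 ⟨⟨d, d, hd.1, 0, zero_mem_nonunitSet, by simp⟩,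
      ⟨d, hd, 0, zero_mem_nonunitSet, by simp⟩, rfl⟩⟩
  by_contra hxW
  have hx0 : x ≠ 0 := fun h => hxW (h ▸ W.zero_mem)
  have hi : x⁻¹ ∈ nonunitSet W.toSubring := mem_nonunitSet_iff.2
    ⟨(W.mem_or_inv_mem x).resolve_left hxW, fun _ h => hxW (by simpa using h)⟩
  exact notMem_nonunitSet (inv_ne_zero hx0) (by simpa using hx) (hM hi)

end RingA

/-! ## The Kronecker function ring of the maximal excluding family -/

section Comap

variable {K L : Type*} [Field K] [Field L] (f : K →+* L) {B : Subring L}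

theorem mem_nonunitSet_comap {x : K} : x ∈ nonunitSet (B.comap f) ↔ f x ∈ nonunitSet B := by
  simp [mem_nonunitSet_iff, Subring.mem_comap]

theorem isLocalRing_comap [IsLocalRing B] : IsLocalRing (B.comap f) := by
  refine isLocalRing_of_inv_mem fun x hx => ?_
  by_cases h : f x ∈ nonunitSet B
  · right
    refine ne_zero_and_inv_mem (Subring.sub_mem _ (Subring.one_mem _) hx) fun hn => ?_
    rw [mem_nonunitSet_comap] at hn
    exact one_notMem_nonunitSet (by simpa using add_mem_nonunitSet hn h)
  · left
    exact ne_zero_and_inv_mem hx fun hn => h ((mem_nonunitSet_comap f).1 hn)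

end Comap

/-! ### Polynomials inside subrings of `F(t)`. -/

section Polynomials

variable {F : Type*} [Field F] {L : Subring (RatFunc F)}

theorem algebraMap_eq_sum (f : F[X]) : algebraMap F[X] (RatFunc F) f =
    ∑ i ∈ f.support, RatFunc.X ^ i * RatFunc.C (f.coeff i) := by
  conv_lhs => rw [f.as_sum_support_C_mul_X_pow]
  rw [map_sum]
  refine Finset.sum_congr rfl fun i _ => ?_
  rw [map_mul, map_pow, RatFunc.algebraMap_C, RatFunc.algebraMap_X, mul_comm]

theorem algebraMap_mem_of_coeff_mem (hX : RatFunc.X ∈ L) {f : F[X]}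
    (hf : ∀ i, RatFunc.C (f.coeff i) ∈ L) : algebraMap F[X] (RatFunc F) f ∈ L := by
  rw [algebraMap_eq_sum]
  exact L.sum_mem fun i _ => L.mul_mem (L.pow_mem hX i) (hf i)

theorem algebraMap_mem_nonunitSet_of_coeff_mem [IsLocalRing L] (hX : RatFunc.X ∈ L) {f : F[X]}
    (hf : ∀ i, RatFunc.C (f.coeff i) ∈ nonunitSet L) :
    algebraMap F[X] (RatFunc F) f ∈ nonunitSet L := by
  rw [algebraMap_eq_sum]
  exact sum_mem_nonunitSet _ fun i _ => mul_mem_nonunitSet (L.pow_mem hX i) (hf i)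

theorem X_mem_nagataRing (A : Subring F) : RatFunc.X ∈ nagataRing A := by
  rw [← RatFunc.algebraMap_X]
  refine algebraMap_mem_nagataRing fun i => ?_
  rw [coeff_X]
  split_ifs <;> simp

end Polynomials

/-! ### The Kronecker function ring as the intersection of the rings `A_V(t)`. -/

section Main

variable {F' F : Type*} [Field F'] [Field F] [Algebra F' F]

/-- Rational functions over `F` can be written with a denominator over `F'` that is primitive over
a given valuation ring of `F'`. -/
theorem exists_eq_div_map [Algebra.IsAlgebraic F' F] (V : ValuationSubring F') (φ : RatFunc F) :
    ∃ (h : F[X]) (G : F'[X]) (k : ℕ), (∀ i, G.coeff i ∈ V) ∧ G.coeff k = 1 ∧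
      φ = algebraMap F[X] (RatFunc F) h /
        algebraMap F[X] (RatFunc F) (G.map (algebraMap F' F)) := by
  obtain ⟨f, g, hg, rfl⟩ := IsFractionRing.div_surjective (A := F[X]) φ
  obtain ⟨G, hG, c, hc⟩ := Polynomial.exists_dvd_map_of_isAlgebraic (R := F')
    (nonZeroDivisors.ne_zero hg)
  obtain ⟨k, hk, hkV⟩ := exists_coeff_div_mem V hG
  have hGm : G.map (algebraMap F' F) ≠ 0 :=
    (Polynomial.map_ne_zero_iff (algebraMap F' F).injective).2 hG
  have hc0 : c ≠ 0 := fun h => hGm (by rw [hc, h, mul_zero])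
  have hd : C (algebraMap F' F (G.coeff k)⁻¹) ≠ 0 := by simpa using hk
  refine ⟨f * c * C (algebraMap F' F (G.coeff k)⁻¹), G * C (G.coeff k)⁻¹, k, fun i => ?_, ?_, ?_⟩
  · rw [coeff_mul_C, ← div_eq_mul_inv]
    exact hkV i
  · rw [coeff_mul_C, mul_inv_cancel₀ hk]
  · rw [Polynomial.map_mul, map_C, hc, map_mul, map_mul, map_mul, map_mul,
      mul_div_mul_right _ _ (RatFunc.algebraMap_ne_zero hd),
      mul_div_mul_right _ _ (RatFunc.algebraMap_ne_zero hc0)]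

theorem base_mem_ringA {D : Subring F} {V : ValuationSubring F'} {v : F'} (hv : v ∈ V) :
    algebraMap F' F v ∈ ringA D V :=
  map_le_ringA ⟨v, hv, rfl⟩

/-- Write `φ = h/G` with `G` primitive over `V`. A coefficient of `h` outside `A_V` would be missing
from some maximal excluding `A ⊇ A_V`; but `h = φ G` lies in `A(t)`, so its coefficients lie in `A`.
-/
theorem krFamily_le_nagataRing_ringA [Algebra.IsAlgebraic F' F] {D : Subring F} {D' : Subring F'}
    {V : ValuationSubring F'} (hV : V ∈ dominatingValuations D') :
    krFamily (maxExcludingFamily D' D) ≤ nagataRing (ringA D V) := by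
  intro φ hφ
  simp only [krFamily, Subring.mem_iInf] at hφ
  obtain ⟨h, G, k, hG, hk, rfl⟩ := exists_eq_div_map V φ
  have hG' : ∀ A, ringA D V ≤ A → ∀ i, (G.map (algebraMap F' F)).coeff i ∈ A := fun A hA i => by
    rw [coeff_map]
    exact hA (base_mem_ringA (hG i))
  have hk' : (G.map (algebraMap F' F)).coeff k = 1 := by rw [coeff_map, hk, map_one]
  have hk0 : (G.map (algebraMap F' F)).coeff k ≠ 0 := hk' ▸ one_ne_zero
  refine div_mem_nagataRing (k := k) (fun i => ?_) (hG' _ le_rfl) hk0 (by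
    rw [hk', inv_one]
    exact Subring.one_mem _)
  by_contra hi
  obtain ⟨A, hA, hVA, hiA⟩ := exists_isMaximalExcluding hi
  have := hA.isLocalRing
  have h1 := Subring.mul_mem _ (hφ A ⟨hA, V, hV, hVA⟩) (algebraMap_mem_nagataRing (hG' A hVA))
  rw [div_mul_cancel₀ _ (algebraMap_ne_zero_of_coeff hk0)] at h1
  exact hiA (coeff_mem_of_algebraMap_mem_nagataRing h1 i)

theorem mem_krFamily_iff [Algebra.IsAlgebraic F' F] {D : Subring F} {D' : Subring F'}
    {φ : RatFunc F} : φ ∈ krFamily (maxExcludingFamily D' D) ↔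
      ∀ V ∈ dominatingValuations D', φ ∈ nagataRing (ringA D V) := by
  refine ⟨fun h V hV => krFamily_le_nagataRing_ringA hV h, fun h => ?_⟩
  simp only [krFamily, Subring.mem_iInf]
  rintro A ⟨-, V, hV, hVA⟩
  exact nagataRing_mono hVA (h V hV)

theorem nonempty_dominatingValuations (D' : Subring F') [IsLocalRing D'] :
    (dominatingValuations D').Nonempty := by
  obtain ⟨V, -, h1, h2⟩ := exists_le_dominating (D := D') (W := ⊤) le_top
  exact ⟨V, h1, h2⟩

variable [Algebra.IsAlgebraic F' F] {D : Subring F} {D' : Subring F'}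

theorem X_mem_krFamily : RatFunc.X ∈ krFamily (maxExcludingFamily D' D) :=
  mem_krFamily_iff.2 fun _ _ => X_mem_nagataRing _

theorem C_mem_krFamily (hinter : ∀ V ∈ dominatingValuations D', D ≤ ringA D V) {d : F}
    (hd : d ∈ D) : RatFunc.C d ∈ krFamily (maxExcludingFamily D' D) :=
  mem_krFamily_iff.2 fun V hV => C_mem_nagataRing (hinter V hV hd)

/-- A nonzero polynomial over `F'` divides its coefficients in the Kronecker function ring. -/
theorem coeff_div_mem_krFamily {G : F'[X]} (hG : G ≠ 0) (i : ℕ) :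
    RatFunc.C (algebraMap F' F (G.coeff i)) /
      algebraMap F[X] (RatFunc F) (G.map (algebraMap F' F)) ∈
        krFamily (maxExcludingFamily D' D) := by
  refine mem_krFamily_iff.2 fun V _ => ?_
  -- The normalizing index `k` depends on `V`; the quotient itself does not.
  obtain ⟨k, hk, hkV⟩ := exists_coeff_div_mem V hG
  have hd : C (algebraMap F' F (G.coeff k)⁻¹) ≠ 0 := by simpa using hk
  have hco : ∀ j, ((G * C (G.coeff k)⁻¹).map (algebraMap F' F)).coeff j =
      algebraMap F' F (G.coeff j / G.coeff k) := fun j => by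
    rw [coeff_map, coeff_mul_C, div_eq_mul_inv]
  have e : RatFunc.C (algebraMap F' F (G.coeff i)) /
      algebraMap F[X] (RatFunc F) (G.map (algebraMap F' F)) =
      algebraMap F[X] (RatFunc F) (C (algebraMap F' F (G.coeff i / G.coeff k))) /
      algebraMap F[X] (RatFunc F) ((G * C (G.coeff k)⁻¹).map (algebraMap F' F)) := by
    rw [div_eq_mul_inv (G.coeff i), map_mul (algebraMap F' F), C_mul, Polynomial.map_mul, map_C,
      map_mul, map_mul, mul_div_mul_right _ _ (RatFunc.algebraMap_ne_zero hd),
      RatFunc.algebraMap_C]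
  rw [e]
  refine div_mem_nagataRing (k := k) (fun j => ?_) (fun j => ?_) ?_ ?_
  · rw [coeff_C]
    split_ifs
    · exact base_mem_ringA (hkV i)
    · exact Subring.zero_mem _
  · rw [hco]
    exact base_mem_ringA (hkV j)
  · rw [hco, div_self hk, map_one]
    exact one_ne_zero
  · rw [hco, div_self hk, map_one, inv_one]
    exact Subring.one_mem _

/-- The Jacobson radical of the Kronecker function ring contains the elements that are nonunits in
all the local rings `A_V(t)`. -/
theorem mem_of_forall_mem_nonunitSet [IsLocalRing D']
    (hloc : ∀ V ∈ dominatingValuations D', IsLocalRing (ringA D V))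
    {p : Ideal (krFamily (maxExcludingFamily D' D))} (hp : p.IsMaximal)
    {φ : krFamily (maxExcludingFamily D' D)}
    (hφ : ∀ V ∈ dominatingValuations D', (φ : RatFunc F) ∈ nonunitSet (nagataRing (ringA D V))) :
    φ ∈ p := by
  by_contra hn
  obtain ⟨r, hr⟩ := hp.exists_inv hn
  obtain ⟨i, hi, e⟩ := hr
  -- If `φ ∉ p`, then `i = 1 - rφ` lies in `p` for some `r`, yet it is a unit in every `A_V(t)` and
  -- so in their intersection.
  have hu : IsUnit i := by
    refine (isUnit_mk_iff i.2).2 ?_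
    have e' : (i : RatFunc F) = 1 - r * φ := by
      rw [eq_sub_iff_add_eq']
      exact congrArg Subtype.val e
    have key : ∀ V ∈ dominatingValuations D',
        (i : RatFunc F) ≠ 0 ∧ (i : RatFunc F)⁻¹ ∈ nagataRing (ringA D V) := fun V hV => by
      have := hloc V hV
      have := isLocalRing_nagataRing (ringA D V)
      refine ne_zero_and_inv_mem (mem_krFamily_iff.1 i.2 V hV) ?_
      rw [e', sub_eq_add_neg]
      exact add_notMem_nonunitSet one_notMem_nonunitSet
        (neg_mem_nonunitSet (mul_mem_nonunitSet (mem_krFamily_iff.1 r.2 V hV) (hφ V hV)))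
    refine ⟨fun h0 => ?_, mem_krFamily_iff.2 fun V hV => (key V hV).2⟩
    obtain ⟨V, hV⟩ := nonempty_dominatingValuations D'
    exact (key V hV).1 h0
  exact hp.ne_top (Ideal.eq_top_of_isUnit_mem _ hi hu)

end Main

/-! ### Quotient field, integral closure and localizations of the Kronecker function ring. -/

section Main

variable {F' F : Type*} [Field F'] [Field F] [Algebra F' F]

/-- If `F` is the quotient field of `D`, then `F(t)` is the quotient field of every subring that
contains `D` and `t`. -/
theorem isFractionRing_of_le {D : Subring F} [IsFractionRing D F] {R : Subring (RatFunc F)}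
    (hX : RatFunc.X ∈ R) (hD : ∀ d ∈ D, RatFunc.C d ∈ R) : IsFractionRing R (RatFunc F) := by
  have hC : ∀ x : F, RatFunc.C x ∈ Subfield.closure (R : Set (RatFunc F)) := fun x => by
    obtain ⟨a, b, -, rfl⟩ := IsFractionRing.div_surjective (A := D) x
    rw [map_div₀]
    exact Subfield.div_mem _ (Subfield.subset_closure (hD a a.2))
      (Subfield.subset_closure (hD b b.2))
  have hpoly : ∀ f : F[X],
      algebraMap F[X] (RatFunc F) f ∈ Subfield.closure (R : Set (RatFunc F)) := fun f =>
    algebraMap_mem_of_coeff_mem (L := (Subfield.closure (R : Set (RatFunc F))).toSubring)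
      (Subfield.subset_closure hX) fun i => hC _
  refine IsFractionRing.of_field R (RatFunc F) fun φ => ?_
  have hφ : φ ∈ Subfield.closure (R : Set (RatFunc F)) := by
    obtain ⟨f, g, -, rfl⟩ := IsFractionRing.div_surjective (A := F[X]) φ
    exact Subfield.div_mem _ (hpoly f) (hpoly g)
  obtain ⟨y, hy, z, hz, rfl⟩ := Subfield.mem_closure_iff.1 hφ
  rw [Subring.closure_eq] at hy hz
  exact ⟨⟨y, hy⟩, ⟨z, hz⟩, rfl⟩

/-- The Nagata ring of a valuation ring of `F`, as a valuation ring of `F(t)`. -/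
noncomputable def nagataValuationSubring (W : ValuationSubring F) : ValuationSubring (RatFunc F) :=
  { nagataRing W.toSubring with mem_or_inv_mem' := mem_or_inv_mem_nagataRing W }

variable [Algebra.IsAlgebraic F' F] {D : Subring F} {D' : Subring F'}

/-- Shrink `W` to a valuation ring `W₁` centered on `𝔪_D` and put `V = W₁ ∩ F'`; then `W₁` dominates
`D` and `V`, so `A_V ⊆ W₁ ⊆ W`. -/
theorem krFamily_le_nagataRing [IsLocalRing D]
    (hle : D'.map (algebraMap F' F) ≤ D)
    (hm : algebraMap F' F '' nonunitSet D' ⊆ nonunitSet D)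
    {W : ValuationSubring F} (hW : D ≤ W.toSubring) :
    krFamily (maxExcludingFamily D' D) ≤ nagataRing W.toSubring := by
  obtain ⟨W₁, hle₁, hD₁, hm₁⟩ := exists_le_dominating hW
  have := isLocalRing_toSubring W₁
  let V : ValuationSubring F' := W₁.comap (algebraMap F' F)
  have hnon : ∀ a : F', a ∈ nonunitSet V.toSubring ↔
      algebraMap F' F a ∈ nonunitSet W₁.toSubring := fun a =>
    mem_nonunitSet_comap (algebraMap F' F) (B := W₁.toSubring)
  have hV : V ∈ dominatingValuations D' :=
    ⟨fun x hx => hD₁ (hle ⟨x, hx, rfl⟩), fun a ha => (hnon a).2 (hm₁ (hm ⟨a, ha, rfl⟩))⟩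
  have hdom : Dominates W₁.toSubring D V := by
    refine ⟨?_, fun a ha => (hnon a).1 ha, hm₁⟩
    rintro _ ⟨v, hv, rfl⟩
    exact hv
  exact (krFamily_le_nagataRing_ringA hV).trans
    (nagataRing_mono (hdom.ringA_le.trans hle₁))

theorem le_intClosure {L : Type*} [Field L] (B : Subring L) : B ≤ intClosure B :=
  fun x hx => isIntegral_algebraMap (R := B) (x := ⟨x, hx⟩)

theorem intClosure_le_toSubring {L : Type*} [Field L] {B : Subring L} {U : ValuationSubring L}
    (h : B ≤ U.toSubring) : intClosure B ≤ U.toSubring :=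
  fun _ hx => mem_of_isIntegralElem U (algebraMap B L) (fun r => h r.2) hx

/-- Only the inverses of primitive polynomials `g` over `W = U ∩ F` are at issue. If `gc = G` is
over `F'`, then `1/g = c/G`. With `b` and `γ` coefficients of largest value of `c` and `G`, both
`c/b` and `γ/G` lie in `U`, and Gauss's lemma gives `b/γ ∈ W`. -/
theorem nagataRing_le_of_krFamily_le
    {U : ValuationSubring (RatFunc F)}
    (hU : krFamily (maxExcludingFamily D' D) ≤ U.toSubring) :
    nagataRing (U.comap RatFunc.C).toSubring ≤ U.toSubring := by
  set W : ValuationSubring F := U.comap RatFunc.C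
  have := isLocalRing_toSubring W
  have hX : RatFunc.X ∈ U.toSubring := hU X_mem_krFamily
  have hpoly : ∀ f : F[X], (∀ i, f.coeff i ∈ W) → algebraMap F[X] (RatFunc F) f ∈ U.toSubring :=
    fun f hf => algebraMap_mem_of_coeff_mem hX hf
  intro φ hφ
  obtain ⟨f, g, hf, hg, ⟨k, hk0, hk⟩, rfl⟩ := exists_of_mem_nagataRing hφ
  rw [div_eq_mul_inv]
  refine Subring.mul_mem _ (hpoly f hf) ?_
  have hg0 : g ≠ 0 := fun h => hk0 (by simp [h])
  obtain ⟨G, hG, c, hc⟩ := Polynomial.exists_dvd_map_of_isAlgebraic (R := F') hg0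
  have hGm : G.map (algebraMap F' F) ≠ 0 :=
    (Polynomial.map_ne_zero_iff (algebraMap F' F).injective).2 hG
  have hc0 : c ≠ 0 := fun h => hGm (by rw [hc, h, mul_zero])
  have ag0 := RatFunc.algebraMap_ne_zero hg0
  have ac0 := RatFunc.algebraMap_ne_zero hc0
  obtain ⟨l, hl, hlW⟩ := exists_coeff_div_mem W hc0
  obtain ⟨j, hj, hjW⟩ := exists_coeff_div_mem W hGm
  have hone : ∀ i, (1 : F[X]).coeff i ∈ W.toSubring := fun i => by
    rw [coeff_one]
    split_ifs
    · exact W.one_mem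
    · exact W.zero_mem
  have hcW : ∀ i, (c * C (c.coeff l)⁻¹).coeff i ∈ W.toSubring := fun i => by
    rw [coeff_mul_C, ← div_eq_mul_inv]
    exact hlW i
  have hcl : (c * C (c.coeff l)⁻¹).coeff l = 1 := by rw [coeff_mul_C, mul_inv_cancel₀ hl]
  have hGW : ∀ i, (G.map (algebraMap F' F) * C ((G.map (algebraMap F' F)).coeff j)⁻¹).coeff i ∈
      W.toSubring := fun i => by
    rw [coeff_mul_C, ← div_eq_mul_inv]
    exact hjW i
  set b := c.coeff l
  set γ := (G.map (algebraMap F' F)).coeff j with hγ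
  have Cb : RatFunc.C b ≠ 0 := by simpa using hl
  have Cγ : RatFunc.C γ ≠ 0 := by simpa using hj
  -- The constant `b/γ` is the product of `1/g`, `b/c` and `G/γ`, all in `W(t)`.
  have hgauss : b / γ ∈ W := by
    have h1 : 1 / algebraMap F[X] (RatFunc F) g ∈ nagataRing W.toSubring := by
      have := div_mem_nagataRing hone hg hk0 hk
      rwa [map_one] at this
    have h2 : 1 / algebraMap F[X] (RatFunc F) (c * C b⁻¹) ∈ nagataRing W.toSubring := by
      have := div_mem_nagataRing hone hcW (k := l) (by rw [hcl]; exact one_ne_zero)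
        (by rw [hcl, inv_one]; exact W.one_mem)
      rwa [map_one] at this
    have h3 := Subring.mul_mem _ (Subring.mul_mem _ h1 h2) (algebraMap_mem_nagataRing hGW)
    have e : 1 / algebraMap F[X] (RatFunc F) g * (1 / algebraMap F[X] (RatFunc F) (c * C b⁻¹)) *
        algebraMap F[X] (RatFunc F) (G.map (algebraMap F' F) * C γ⁻¹) =
        algebraMap F[X] (RatFunc F) (C (b / γ)) := by
      rw [hc]
      simp only [map_mul, RatFunc.algebraMap_C, map_inv₀, map_div₀]
      field_simp
    rw [e] at h3
    simpa using coeff_mem_of_algebraMap_mem_nagataRing h3 0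
  have h4 : RatFunc.C γ / algebraMap F[X] (RatFunc F) (G.map (algebraMap F' F)) ∈ U.toSubring := by
    rw [hγ, coeff_map]
    exact hU (coeff_div_mem_krFamily hG j)
  -- The product `(b/γ)(γ/G)(c/b)` equals `c/G = 1/g`.
  have h5 := Subring.mul_mem _ (Subring.mul_mem _ (show RatFunc.C (b / γ) ∈ U.toSubring from hgauss)
    h4) (hpoly _ hcW)
  convert h5 using 1
  rw [hc]
  simp only [map_mul, RatFunc.algebraMap_C, map_inv₀, map_div₀]
  field_simp

/-- An integral closure in a field is the intersection of the valuation rings above the ring. Those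
above `R` are compared with the rings `W(t)`, where `W` is a valuation overring of `D`, equivalently
of `D̄`. -/
theorem intClosure_krFamily [IsLocalRing D]
    (hle : D'.map (algebraMap F' F) ≤ D)
    (hm : algebraMap F' F '' nonunitSet D' ⊆ nonunitSet D)
    (hinter : ∀ V ∈ dominatingValuations D', D ≤ ringA D V) :
    intClosure (krFamily (maxExcludingFamily D' D)) = kr (intClosure D) := by
  apply le_antisymm
  · intro φ hφ
    simp only [kr, krFamily, Subring.mem_iInf]
    rintro _ ⟨W, hW, rfl⟩
    exact intClosure_le_toSubring (U := nagataValuationSubring W)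
      (krFamily_le_nagataRing hle hm ((le_intClosure D).trans hW)) hφ
  · intro φ hφ
    simp only [kr, krFamily, Subring.mem_iInf] at hφ
    have h := iInf_valuationSubring_superset
      (s := (krFamily (maxExcludingFamily D' D) : Set (RatFunc F)))
    rw [Subring.closure_eq] at h
    rw [intClosure, ← h, Subring.mem_iInf]
    rintro ⟨U, hU⟩
    have hW : D ≤ (U.comap RatFunc.C).toSubring := fun d hd => hU (C_mem_krFamily hinter hd)
    exact nagataRing_le_of_krFamily_le hU
      (hφ _ ⟨_, intClosure_le_toSubring hW, rfl⟩)

/-- The localizations of the Kronecker function ring at its maximal ideals are Nagata rings of rings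
`A_V`. The valuation ring `V` is the intersection of the localization with `F'`. -/
theorem exists_localizationAt_eq [IsLocalRing D']
    (hA : ∀ V ∈ dominatingValuations D', Dominates (ringA D V) D V ∧ IsLocalRing (ringA D V))
    (hle : D'.map (algebraMap F' F) ≤ D)
    (hm : algebraMap F' F '' nonunitSet D' ⊆ nonunitSet D)
    (hinter : ∀ V ∈ dominatingValuations D', D ≤ ringA D V)
    (p : Ideal (krFamily (maxExcludingFamily D' D))) (hp : p.IsMaximal) :
    ∃ V ∈ dominatingValuations D', IsLocalRing (nagataRing (ringA D V)) ∧
      (Subtype.val '' (p : Set (krFamily (maxExcludingFamily D' D))) : Set (RatFunc F)) =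
        nonunitSet (nagataRing (ringA D V)) ∩ (krFamily (maxExcludingFamily D' D) :
          Set (RatFunc F)) ∧
      localizationAt _ p = nagataRing (ringA D V) := by
  have := hp.isPrime
  let R := krFamily (maxExcludingFamily D' D)
  let L := localizationAt R p
  have hL : IsLocalRing L := isLocalRing_localizationAt p
  have hRL : R ≤ L := le_localizationAt p
  have hdiv : ∀ x y : RatFunc F, x ∈ R → (hy : y ∈ R) → (⟨y, hy⟩ : R) ∉ p → x / y ∈ L :=
    fun x y hx hy hyp => (mem_localizationAt R p _).2 ⟨⟨x, hx⟩, ⟨y, hy⟩, hyp, rfl⟩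
  have hX : RatFunc.X ∈ R := X_mem_krFamily
  have hCD : ∀ d ∈ D, RatFunc.C d ∈ R := fun d hd => C_mem_krFamily hinter hd
  -- `𝔪_D` lies in the maximal ideal of every `A_V(t)`, hence in every maximal ideal of `R`.
  have hCm : ∀ d ∈ nonunitSet D, RatFunc.C d ∈ nonunitSet L := fun d hd => by
    refine (coe_mem_nonunitSet_localizationAt p (a := ⟨_, hCD d hd.1⟩)).2 ?_
    refine mem_of_forall_mem_nonunitSet (fun V hV => (hA V hV).2) hp fun V hV => ?_
    have := (hA V hV).2
    exact C_mem_nonunitSet_nagataRing ((hA V hV).1.nonunit hd)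
  let ι : F' →+* RatFunc F := RatFunc.C.comp (algebraMap F' F)
  let V : ValuationSubring F' :=
    { L.comap ι with
      mem_or_inv_mem' := by
        intro x
        change ι x ∈ L ∨ ι x⁻¹ ∈ L
        by_cases hx : x = 0
        · left
          rw [hx, map_zero]
          exact L.zero_mem
        have hιx : RatFunc.C (algebraMap F' F x) ≠ 0 := by simpa using hx
        -- Both `x/(t + x)` and `1/(t + x)` lie in `R`, and `t · 1/(t + x) + x/(t + x) = 1`. So one
        -- of them is outside `p`, and their ratio `x` or its inverse lies in `L`.
        let G : F'[X] := X + C x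
        have hG : G ≠ 0 := X_add_C_ne_zero x
        have hG' := RatFunc.algebraMap_ne_zero
          ((Polynomial.map_ne_zero_iff (algebraMap F' F).injective).2 hG)
        have hGe : algebraMap F[X] (RatFunc F) (G.map (algebraMap F' F)) =
            RatFunc.X + RatFunc.C (algebraMap F' F x) := by simp [G]
        have h0 := coeff_div_mem_krFamily (D := D) (D' := D') hG 0
        have h1 := coeff_div_mem_krFamily (D := D) (D' := D') hG 1
        rw [show G.coeff 0 = x by simp [G]] at h0
        rw [show G.coeff 1 = 1 by simp [G], map_one, map_one] at h1
        rw [hGe] at h0 h1 hG'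
        by_cases hp0 : (⟨_, h0⟩ : R) ∈ p
        · have hp1 : (⟨_, h1⟩ : R) ∉ p := fun hp1 => by
            refine hp.ne_top ((Ideal.eq_top_iff_one p).2 ?_)
            rw [show (1 : R) = ⟨_, hX⟩ * ⟨_, h1⟩ + ⟨_, h0⟩ from Subtype.ext (by
              push_cast
              field_simp)]
            exact p.add_mem (p.mul_mem_left _ hp1) hp0
          left
          have := hdiv _ _ h0 h1 hp1
          rwa [div_div_div_cancel_right₀ hG', div_one] at this
        · right
          have := hdiv _ _ h1 h0 hp0
          rw [div_div_div_cancel_right₀ hG', one_div] at this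
          rwa [map_inv₀] }
  have hVnon : ∀ a : F', a ∈ nonunitSet V.toSubring ↔
      RatFunc.C (algebraMap F' F a) ∈ nonunitSet L := fun a => mem_nonunitSet_comap ι
  have hV : V ∈ dominatingValuations D' :=
    ⟨fun x hx => hRL (hCD _ (hle ⟨x, hx, rfl⟩)),
      fun a ha => (hVnon a).2 (hCm _ (hm ⟨a, ha, rfl⟩))⟩
  have hB : IsLocalRing (L.comap (RatFunc.C : F →+* RatFunc F)) := isLocalRing_comap _
  have hdom : Dominates (L.comap (RatFunc.C : F →+* RatFunc F)) D V := by
    refine ⟨?_, fun a ha => (mem_nonunitSet_comap _).2 ((hVnon a).1 ha),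
      fun d hd => (mem_nonunitSet_comap _).2 (hCm d hd)⟩
    rintro _ ⟨v, hv, rfl⟩
    exact hv
  have hloc : IsLocalRing (ringA D V) := (hA V hV).2
  have hNloc := isLocalRing_nagataRing (ringA D V)
  have hmA : ∀ a ∈ nonunitSet (ringA D V), RatFunc.C a ∈ nonunitSet L := fun a ha =>
    (mem_nonunitSet_comap _).1 (hdom.nonunitSet_ringA_subset ha)
  have hNL : nagataRing (ringA D V) ≤ L := by
    intro φ hφ
    obtain ⟨f, g, hf, hg, ⟨k, hk0, hk⟩, rfl⟩ := exists_of_mem_nagataRing hφ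
    have hpoly : ∀ f : F[X], (∀ i, f.coeff i ∈ ringA D V) → algebraMap F[X] (RatFunc F) f ∈ L :=
      fun f hf => algebraMap_mem_of_coeff_mem (hRL hX) fun i => hdom.ringA_le (hf i)
    rw [div_eq_mul_inv]
    refine L.mul_mem (hpoly f hf) (ne_zero_and_inv_mem (hpoly g hg) ?_).2
    -- Replacing each coefficient of `g` by a representative of its residue class in `V` gives `G`
    -- over `F'` with `g - G` in `𝔪_L`. The unit coefficient `v k` then makes `1/G` an element of
    -- `L`.
    choose v hvV m hm' hvm using fun i => (hA V hV).1.exists_add_of_mem_ringA (hg i)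
    let G : F'[X] := ∑ i ∈ g.support, monomial i (v i)
    have hGc : ∀ i, i ∈ g.support → G.coeff i = v i := fun i hi => by
      simp [G, coeff_monomial, mem_support_iff.1 hi]
    have hGc' : ∀ i, i ∉ g.support → G.coeff i = 0 := fun i hi => by
      simp [G, coeff_monomial, notMem_support_iff.1 hi]
    have hks : k ∈ g.support := mem_support_iff.2 hk0
    have hvk : v k ∉ nonunitSet V.toSubring := fun hn => by
      refine notMem_nonunitSet hk0 hk ?_
      rw [hvm]
      exact add_mem_nonunitSet ((hA V hV).1.nonunit_base _ hn) (hm' k)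
    obtain ⟨hv0, hvi⟩ := ne_zero_and_inv_mem (B := V.toSubring) (hvV k) hvk
    have hG0 : G ≠ 0 := fun h => hv0 (by rw [← hGc k hks, h, coeff_zero])
    have hGm := RatFunc.algebraMap_ne_zero
      ((Polynomial.map_ne_zero_iff (algebraMap F' F).injective).2 hG0)
    have hGinv : (algebraMap F[X] (RatFunc F) (G.map (algebraMap F' F)))⁻¹ ∈ L := by
      have h1 := hRL (coeff_div_mem_krFamily (D := D) (D' := D') hG0 k)
      have h2 := L.mul_mem (show ι (v k)⁻¹ ∈ L from hvi) h1
      rw [hGc k hks] at h2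
      have e : ι (v k)⁻¹ = (RatFunc.C (algebraMap F' F (v k)))⁻¹ := map_inv₀ ι _
      rwa [e, div_eq_mul_inv, inv_mul_cancel_left₀ (by simpa using hv0)] at h2
    have hM : algebraMap F[X] (RatFunc F) (g - G.map (algebraMap F' F)) ∈ nonunitSet L := by
      refine algebraMap_mem_nonunitSet_of_coeff_mem (hRL hX) fun i => hmA _ ?_
      rw [coeff_sub, coeff_map]
      by_cases hi : i ∈ g.support
      · rw [hGc i hi, hvm, add_sub_cancel_left]
        exact hm' i
      · rw [hGc' i hi, notMem_support_iff.1 hi, map_zero, sub_zero]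
        exact zero_mem_nonunitSet
    have := add_notMem_nonunitSet (notMem_nonunitSet hGm hGinv) hM
    rwa [← map_add, add_sub_cancel] at this
  have hRN : R ≤ nagataRing (ringA D V) := krFamily_le_nagataRing_ringA hV
  -- Nonunits of `L` lying in the smaller ring `A_V(t)` are nonunits there, so `p` is contained in
  -- the contraction; maximality of `p` gives equality.
  have hpq : p = (IsLocalRing.maximalIdeal (nagataRing (ringA D V))).comap
      (Subring.inclusion hRN) := by
    refine hp.eq_of_le (Ideal.comap_ne_top _ (IsLocalRing.maximalIdeal.isMaximal _).ne_top)
      fun a ha => ?_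
    refine mem_maximalIdeal_iff.2 (nonunitSet_inter_subset hNL ⟨?_, hRN a.2⟩)
    exact (coe_mem_nonunitSet_localizationAt p).2 ha
  have hmem : ∀ a : R, a ∈ p ↔ (a : RatFunc F) ∈ nonunitSet (nagataRing (ringA D V)) := fun a => by
    rw [hpq, Ideal.mem_comap, mem_maximalIdeal_iff]
    rfl
  refine ⟨V, hV, hNloc, ?_, le_antisymm ?_ hNL⟩
  · ext φ
    constructor
    · rintro ⟨a, ha, rfl⟩
      exact ⟨(hmem a).1 ha, a.2⟩
    · rintro ⟨h1, h2⟩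
      exact ⟨⟨φ, h2⟩, (hmem ⟨φ, h2⟩).2 h1, rfl⟩
  · refine Subring.closure_le.2 ?_
    rintro x (hx | ⟨b, hb, rfl⟩)
    · exact hRN hx
    · exact (ne_zero_and_inv_mem (hRN b.2) fun h => hb ((hmem b).2 h)).2

end Main

end KrRing

theorem theorem5p8 {F' F : Type*} [Field F'] [CharZero F'] [Field F] [Algebra F' F]
    [FiniteDimensional F' F] [IsGalois F' F]
    -- generators `θ 0 = 1, θ 1, …` of `F` as a vector space over `F'`
    (n : ℕ) (θ : Fin (n + 1) → F) (hθ_one : θ 0 = 1)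
    (hθ_span : Submodule.span F' (Set.range θ) = ⊤)
    -- the local domain `D` with quotient field `F`
    (D : Subring F) [IsLocalRing D] [IsFractionRing D F]
    -- the local integrally closed domain `D'` with quotient field `F'`
    (D' : Subring F') [IsLocalRing D'] [IsFractionRing D' F'] [IsIntegrallyClosed D']
    (hstar : KrRing.ChainCondition (F' := F')
      (KrRing.conjugateField (F' := F') θ) (KrRing.intClosure D))
    (hQ : ∀ q : ℚ, (q : F') ∈ D')
    (hm : algebraMap F' F '' KrRing.nonunitSet D' ⊆ KrRing.nonunitSet D)
    (hD : D = KrRing.adjoinLocalized (D'.map (algebraMap F' F))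
      (KrRing.nonunitSet D) (KrRing.nonunitSet D))
    (hD'_closure : (integralClosure D' F).toSubring = KrRing.intClosure D)
    (hD_gen : KrRing.intClosure D = KrRing.adjoin D (Set.range θ))
    (hinter : ⨅ V ∈ KrRing.dominatingValuations D', KrRing.ringA D V = D)
    -- `R = Kr^𝓕(D)`
    (R : Subring (RatFunc F))
    (hR : R = KrRing.krFamily (KrRing.maxExcludingFamily D' D)) :
    IsFractionRing R (RatFunc F) ∧
    KrRing.intClosure R = KrRing.kr (KrRing.intClosure D) ∧
    ∀ p : Ideal R, p.IsMaximal →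
      ∃ V ∈ KrRing.dominatingValuations D',
        IsLocalRing (KrRing.nagataRing (KrRing.ringA D V)) ∧
        (Subtype.val '' (p : Set R) : Set (RatFunc F)) =
          KrRing.nonunitSet (KrRing.nagataRing (KrRing.ringA D V)) ∩ (R : Set (RatFunc F)) ∧
        KrRing.localizationAt R p = KrRing.nagataRing (KrRing.ringA D V) := by
  subst hR
  have hle : D'.map (algebraMap F' F) ≤ D := fun x hx => by
    rw [hD]
    exact KrRing.le_localizationAt _ (Subring.subset_closure (Or.inl hx))
  have hint : ∀ x ∈ D, IsIntegral D' x := fun x hx => by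
    have h := KrRing.le_intClosure D hx
    rw [← hD'_closure] at h
    exact h
  have hDA : ∀ V ∈ KrRing.dominatingValuations D', D ≤ KrRing.ringA D V := fun V hV =>
    hinter.symm.le.trans (iInf₂_le V hV)
  exact ⟨KrRing.isFractionRing_of_le KrRing.X_mem_krFamily
      fun d hd => KrRing.C_mem_krFamily hDA hd,
    KrRing.intClosure_krFamily hle hm hDA,
    KrRing.exists_localizationAt_eq
      (fun V hV => KrRing.dominates_ringA_of_mem hle hint hV) hle hm hDA⟩
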